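/- Let $k$ be a field. Let $(Q,\mathcal P)$ be a thread quiver: a quiver $Q$ (possibly infinite), every vertex of which is the source or the target of at least one arrow, together with a (possibly empty) linearly ordered set $\mathcal P_\alpha$ for each arrow $\alpha:s(\alpha)\to t(\alpha)$. Let $\overline{\mathcal P}_\alpha$ be $\mathcal P_\alpha$ with a new minimum, standing for $s(\alpha)$, and a new maximum, standing for $t(\alpha)$, adjoined (these are distinct even if $\alpha$ is a loop). The path category $\mathcal C$ is the $k$-linear category whose objects are the vertices of $Q$ and the elements of all the $\mathcal P_\alpha$. A basis of $\operatorname{Hom}_{\mathcal C}(x,y)$ is given by the path-like elements: the elements $\eta_{y,x}$ for $x\le y$ in some $\overline{\mathcal P}_\alpha$, and the elements $\eta_{y,s(\beta)}\,p\,\eta_{t(\alpha),x}$ for $x\in\overline{\mathcal P}_\alpha$, $y\in\overline{\mathcal P}_\beta$ and $p$ a path of $Q$ from $t(\alpha)$ to $s(\beta)$. Composition is given by concatenation of paths, $\eta_{z,y}\eta_{y,x}=\eta_{z,x}$ for $x\le y\le z$ in $\overline{\mathcal P}_\alpha$, where $\eta_{\max,\min}$ of $\overline{\mathcal P}_\alpha$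 is the arrow $\alpha$ and $\eta_{x,x}$ is the identity of $x$. Let $\mathcal J$ be the ideal of $\mathcal C$ generated by the path-like elements that are not identities. Let $\mathcal I$ be a weakly admissible ideal of $\mathcal C$, that is, with $\mathcal A=\mathcal C/\mathcal I$: all endomorphism rings $\operatorname{End}_{\mathcal A}(x)$ are local, all $\operatorname{Hom}_{\mathcal A}(x,y)$ are finite-dimensional, and $\mathcal I$ is generated by elements of $\mathcal J$. Let ${\rm rep}^{\rm pwf}\mathcal A$ be the category of $k$-linear functors from $\mathcal A$ to finite-dimensional $k$-vector spaces. Call $\mathcal A$ left (respectively right) $Q$-bounded if for each vertex $x$ of $Q$ there are only finitely many vertices $y$ of $Q$ with $\operatorname{Hom}_{\mathcal A}(y,x)\ne 0$ (respectively $\operatorname{Hom}_{\mathcal A}(x,y)\neq 0$). For an interval $J$ of $\overline{\mathcal P}_\alpha$ (a non-empty subset that contains every $z$ with $x<z<y$ for $x,y\in J$), let $P_J=\varinjlim_{j\in J^{\rm op}}\operatorname{Hom}_{\mathcal A}(j,-)$, with transition maps induced by the $\eta_{j_2,j_1}$, and let $I_J=\operatorname{Hom}_k\bigl(\varinjlim_{j\in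 J}\operatorname{Hom}_{\mathcal A}(-,j),\,k\bigr)$, the dual being taken pointwise. **Theorem.** 1. If $\mathcal A$ is left $Q$-bounded and $P$ is an indecomposable projective object of ${\rm rep}^{\rm pwf}\mathcal A$, then there are an arrow $\alpha$ of $Q$ and an interval $J$ of $\overline{\mathcal P}_\alpha$ with $P\cong P_J$. 2. If $\mathcal A$ is right $Q$-bounded and $E$ is an indecomposable injective object of ${\rm rep}^{\rm pwf}\mathcal A$, then there are an arrow $\alpha$ of $Q$ and an interval $J$ of $\overline{\mathcal P}_\alpha$ with $E\cong I_J$. -/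

import Mathlib

open CategoryTheory CategoryTheory.Limits

universe u

/-- A thread quiver: an arbitrary quiver together with a (possibly empty) linearly ordered set
`thread α` for each arrow `α`. -/
structure ThreadQuiver where
  /-- the vertices of the quiver -/
  Vertex : Type u
  /-- the arrows of the quiver -/
  [quiver : Quiver.{u} Vertex]
  /-- the linearly ordered set attached to an arrow -/
  thread : ∀ {a b : Vertex}, (a ⟶ b) → Type u
  [order : ∀ {a b : Vertex} (α : a ⟶ b), LinearOrder (thread α)]

namespace ThreadQuiver

attribute [instance] ThreadQuiver.quiver ThreadQuiver.order

/-- The objects of the path category: the vertices, and the points of all the threads. -/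
inductive Obj (Q : ThreadQuiver.{u}) : Type u
  | vertex (v : Q.Vertex) : Obj Q
  | point {a b : Q.Vertex} (α : a ⟶ b) (x : Q.thread α) : Obj Q

/-- The path-like elements. With `η` written for the generators, `p` a path of the quiver
and composition from right to left, they are
* `path p = p`,
* `into p α y = η_{y,s(α)} p`,
* `out α x p = p η_{t(α),x}`,
* `through α x p β y = η_{y,s(β)} p η_{t(α),x}`,
* `seg α h = η_{y,x}` for two points `x ≤ y` of the thread of `α`. -/
inductive PathLike (Q : ThreadQuiver.{u}) : Obj Q → Obj Q → Type u
  | path {a b : Q.Vertex} (p : Quiver.Path a b) : PathLike Q (.vertex a) (.vertex b)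
  | into {a c d : Q.Vertex} (p : Quiver.Path a c) (α : c ⟶ d) (y : Q.thread α) :
      PathLike Q (.vertex a) (.point α y)
  | out {a b d : Q.Vertex} (α : a ⟶ b) (x : Q.thread α) (p : Quiver.Path b d) :
      PathLike Q (.point α x) (.vertex d)
  | through {a b c d : Q.Vertex} (α : a ⟶ b) (x : Q.thread α) (p : Quiver.Path b c)
      (β : c ⟶ d) (y : Q.thread β) : PathLike Q (.point α x) (.point β y)
  | seg {a b : Q.Vertex} (α : a ⟶ b) {x y : Q.thread α} (h : x ≤ y) :
      PathLike Q (.point α x) (.point α y)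

namespace PathLike

variable {Q : ThreadQuiver.{u}}

/-- The trivial path at an object. -/
def id : (X : Obj Q) → PathLike Q X X
  | .vertex _ => path Quiver.Path.nil
  | .point α x => seg α (le_refl x)

/-- Concatenation of path-like elements, in diagrammatic order. It is determined by concatenation
of paths, by `η_{z,y} η_{y,x} = η_{z,x}` and by `η_{t(α),x} η_{x,s(α)} = α`. -/
def comp : {X Y Z : Obj Q} → PathLike Q X Y → PathLike Q Y Z → PathLike Q X Z
  | _, _, _, path p, path q => path (p.comp q)
  | _, _, _, path p, into q β y => into (p.comp q) β y
  | _, _, _, into p α _, out _ _ q => path ((p.cons α).comp q)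
  | _, _, _, into p α _, through _ _ q β z => into ((p.cons α).comp q) β z
  | _, _, _, into p α _, seg _ (y := z) _ => into p α z
  | _, _, _, out α x p, path q => out α x (p.comp q)
  | _, _, _, out α x p, into q β y => through α x (p.comp q) β y
  | _, _, _, through α x p β _, out _ _ q => out α x ((p.cons β).comp q)
  | _, _, _, through α x p β _, through _ _ q γ z => through α x ((p.cons β).comp q) γ z
  | _, _, _, through α x p β _, seg _ (y := z) _ => through α x p β z
  | _, _, _, seg α (x := x) _, out _ _ q => out α x q
  | _, _, _, seg α (x := x) _, through _ _ q β z => through α x q β z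
  | _, _, _, seg α h, seg _ h' => seg α (h.trans h')

end PathLike

/-- The category whose morphisms are the path-like elements. -/
instance (Q : ThreadQuiver.{u}) : Category.{u} (Obj Q) where
  Hom := PathLike Q
  id := PathLike.id
  comp := PathLike.comp
  id_comp f := by cases f <;> simp [PathLike.id, PathLike.comp]
  comp_id f := by cases f <;> simp [PathLike.id, PathLike.comp]
  assoc f g h := by
    cases f <;> cases g <;> cases h <;>
      simp [PathLike.comp, Quiver.Path.comp_assoc, ← Quiver.Path.comp_cons]

/-- `threadBar α` is the thread of `α` with a new minimum `⊥` (standing for `s(α)`) and a new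
maximum `⊤` (standing for `t(α)`) adjoined. The two are distinct also when `α` is a loop. -/
abbrev threadBar (Q : ThreadQuiver.{u}) {a b : Q.Vertex} (α : a ⟶ b) : Type u :=
  WithBot (WithTop (Q.thread α))

variable {Q : ThreadQuiver.{u}}

/-- The object of the path category given by an element of `threadBar α`. -/
def toObj {a b : Q.Vertex} (α : a ⟶ b) : Q.threadBar α → Obj Q
  | none => .vertex a
  | some none => .vertex b
  | some (some x) => .point α x

/-- The path-like element `η_{y,x}` for `x ≤ y` in `threadBar α`. -/
def eta {a b : Q.Vertex} (α : a ⟶ b) : {x y : Q.threadBar α} → x ≤ y → (toObj α x ⟶ toObj α y)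
  | none, none, _ => .path Quiver.Path.nil
  | none, some none, _ => .path α.toPath
  | none, some (some y), _ => .into Quiver.Path.nil α y
  | some none, none, h => absurd h (WithBot.not_coe_le_bot _)
  | some none, some none, _ => .path Quiver.Path.nil
  | some none, some (some y), h => absurd (WithBot.coe_le_coe.1 h) (WithTop.not_top_le_coe y)
  | some (some _), none, h => absurd h (WithBot.not_coe_le_bot _)
  | some (some x), some none, _ => .out α x Quiver.Path.nil
  | some (some _), some (some _), h => .seg α (WithTop.coe_le_coe.1 (WithBot.coe_le_coe.1 h))

/-- The functor from the ordered set `threadBar α` given by the `η_{y,x}`. -/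
def threadFunctor {a b : Q.Vertex} (α : a ⟶ b) : Q.threadBar α ⥤ Obj Q where
  obj := toObj α
  map f := eta α (leOfHom f)
  map_id x := by
    rcases x with _ | _ | x <;> rfl
  map_comp {x y z} f g := by
    have hf := leOfHom f
    have hg := leOfHom g
    rcases x with _ | _ | x <;> rcases y with _ | _ | y <;> rcases z with _ | _ | z <;>
    first
    | rfl
    | exact absurd hf (WithBot.not_coe_le_bot _)
    | exact absurd hg (WithBot.not_coe_le_bot _)
    | exact absurd (WithBot.coe_le_coe.1 hf) (WithTop.not_top_le_coe _)
    | exact absurd (WithBot.coe_le_coe.1 hg) (WithTop.not_top_le_coe _)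

end ThreadQuiver

/-- A (two-sided) ideal of a `k`-linear category. -/
structure HomIdeal (k : Type u) [Field k] (C : Type u) [Category.{u} C] [Preadditive C]
    [Linear k C] where
  /-- the morphisms of the ideal -/
  hom : ∀ X Y : C, Submodule k (X ⟶ Y)
  comp_left : ∀ {X Y Z : C} (f : X ⟶ Y) {g : Y ⟶ Z}, g ∈ hom Y Z → f ≫ g ∈ hom X Z
  comp_right : ∀ {X Y Z : C} {f : X ⟶ Y} (g : Y ⟶ Z), f ∈ hom X Y → f ≫ g ∈ hom X Z

namespace HomIdeal

variable {k : Type u} [Field k] {C : Type u} [Category.{u} C] [Preadditive C] [Linear k C]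

/-- The smallest ideal that contains a given class `S` of morphisms. -/
def generatedBy (S : ∀ X Y : C, Set (X ⟶ Y)) : HomIdeal k C where
  hom X Y := ⨅ I : {I : HomIdeal k C // ∀ X Y, S X Y ⊆ I.hom X Y}, I.1.hom X Y
  comp_left f _ hg := by
    simp only [Submodule.mem_iInf] at hg ⊢
    exact fun I => I.1.comp_left f (hg I)
  comp_right g hf := by
    simp only [Submodule.mem_iInf] at hf ⊢
    exact fun I => I.1.comp_right g (hf I)

variable (I : HomIdeal k C)

/-- Congruence of morphisms modulo an ideal. -/
def rel : HomRel C := fun X Y f g => f - g ∈ I.hom X Y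

instance : Congruence I.rel where
  comp_left f _ _ h := by
    simpa only [rel, Preadditive.comp_sub] using I.comp_left f h
  comp_right g h := by
    simpa only [rel, Preadditive.sub_comp] using I.comp_right g h
  equivalence :=
    { refl := fun f => by simp [rel]
      symm := fun {f g} h => by simpa [rel] using neg_mem h
      trans := fun {f g l} h h' => by simpa [rel] using add_mem h h' }

/-- The quotient of a `k`-linear category by an ideal. -/
abbrev Quot : Type u := CategoryTheory.Quotient I.rel

/-- The quotient functor. -/
abbrev proj : C ⥤ I.Quot := CategoryTheory.Quotient.functor I.rel

instance : Preadditive I.Quot :=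
  CategoryTheory.Quotient.preadditive I.rel fun X Y f₁ f₂ g₁ g₂ hf hg => by
    have := add_mem hf hg
    rwa [sub_add_sub_comm] at this

instance : I.proj.Additive where
  map_add := rfl

instance : Linear k I.Quot :=
  CategoryTheory.Quotient.linear k I.rel fun a X Y f₁ f₂ hf => by
    have := (I.hom X Y).smul_mem a hf
    rwa [smul_sub] at this

instance : I.proj.Linear k where
  map_smul _ _ := rfl

end HomIdeal

section Representations

variable (k : Type u) [Field k] (A : Type u) [Category.{u} A] [Preadditive A] [Linear k A]

/-- The pointwise finite-dimensional representations of `A`, among all functors from `A` to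
vector spaces: the `k`-linear functors all of whose values are finite-dimensional. -/
def isPwf : ObjectProperty (A ⥤ ModuleCat.{u} k) := fun M =>
  (M.Additive ∧ M.Linear k) ∧ ∀ x : A, FiniteDimensional k (M.obj x)

/-- The category of pointwise finite-dimensional representations of `A`. -/
abbrev RepPwf : Type (u + 1) := (isPwf k A).FullSubcategory

instance : (isPwf k A).IsClosedUnderBinaryProducts where
  limitsOfShape_le := by
    rintro M ⟨p⟩
    have hP := p.prop_diag_obj
    have hext : ∀ (x : A) {W : ModuleCat.{u} k} (f g : W ⟶ M.obj x),
        (∀ j, f ≫ (p.π.app j).app x = g ≫ (p.π.app j).app x) → f = g := fun x W f g h =>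
      (isLimitOfPreserves ((evaluation A (ModuleCat.{u} k)).obj x) p.isLimit).hom_ext h
    refine ⟨⟨⟨fun {X Y f g} => hext Y _ _ fun j => ?_⟩, ⟨fun {X Y} f r => hext Y _ _ fun j => ?_⟩⟩,
      fun x => ?_⟩
    · have := (hP j).1.1
      simp only [NatTrans.naturality, Preadditive.add_comp, Functor.map_add, Preadditive.comp_add]
    · have := (hP j).1.2
      simp only [NatTrans.naturality, Linear.smul_comp, Functor.map_smul, Linear.comp_smul]
    · have := fun j => (hP j).2 x
      have : FiniteDimensional k (∀ j : WalkingPair, (p.diag.obj ⟨j⟩).obj x) :=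
        Module.Finite.pi
      let φ : M.obj x →ₗ[k] ∀ j : WalkingPair, (p.diag.obj ⟨j⟩).obj x :=
        LinearMap.pi fun j => ((p.π.app ⟨j⟩).app x).hom
      refine FiniteDimensional.of_injective φ ?_
      refine (injective_iff_map_eq_zero _).2 fun v hv => ?_
      have h0 := hext x (ModuleCat.ofHom (LinearMap.toSpanSingleton k (M.obj x) v)) 0
        fun ⟨j⟩ => by
          ext
          have h1 : ((p.π.app ⟨j⟩).app x).hom v = 0 := congrFun hv j
          simpa using h1
      simpa using congrArg (fun f => f.hom 1) h0


noncomputable instance : HasBinaryBiproducts (RepPwf k A) :=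
  HasBinaryBiproducts.of_hasBinaryProducts

/-- The functor `Hom_k(-, k)` on vector spaces. -/
def dualFunctor : (ModuleCat.{u} k)ᵒᵖ ⥤ ModuleCat.{u} k where
  obj V := ModuleCat.of k (Module.Dual k V.unop)
  map f := ModuleCat.ofHom f.unop.hom.dualMap

end Representations

namespace ThreadQuiver

variable (k : Type u) [Field k] (Q : ThreadQuiver.{u})

/-- The path category: its morphisms are the formal `k`-linear combinations of path-like
elements. -/
abbrev PathCategory : Type u := Free k (Obj Q)

/-- The path-like radical: the ideal generated by the path-like elements that are not trivial
paths. -/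
noncomputable def pathRadical : HomIdeal k (PathCategory k Q) :=
  HomIdeal.generatedBy fun X Y : Obj Q =>
    {f | ∃ p : X ⟶ Y, (∀ h : X = Y, p ≠ eqToHom h) ∧ f = (Free.embedding k (Obj Q)).map p}

variable {k Q} (I : HomIdeal k (PathCategory k Q))

/-- Weakly admissible ideals of the path category. -/
structure WeaklyAdmissible : Prop where
  isLocalRing_end : ∀ x : I.Quot, IsLocalRing (End x)
  finite_hom : ∀ x y : I.Quot, FiniteDimensional k (x ⟶ y)
  generated : ∃ S : ∀ X Y : PathCategory k Q, Set (X ⟶ Y),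
    (∀ X Y, S X Y ⊆ (pathRadical k Q).hom X Y) ∧ I = HomIdeal.generatedBy S

/-- A vertex as an object of the quotient category. -/
noncomputable abbrev vertexObj (v : Q.Vertex) : I.Quot := I.proj.obj (Free.of k (Obj.vertex v))

/-- Left `Q`-boundedness of the quotient category. -/
def LeftBounded : Prop :=
  ∀ x : Q.Vertex, {y : Q.Vertex | ∃ f : vertexObj I y ⟶ vertexObj I x, f ≠ 0}.Finite

/-- Right `Q`-boundedness of the quotient category. -/
def RightBounded : Prop :=
  ∀ x : Q.Vertex, {y : Q.Vertex | ∃ f : vertexObj I x ⟶ vertexObj I y, f ≠ 0}.Finite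

variable {a b : Q.Vertex} (α : a ⟶ b) (J : Set (Q.threadBar α))

/-- The diagram in the quotient category given by the elements of `J` and the `η_{y,x}`. -/
noncomputable def intervalFunctor : J ⥤ I.Quot :=
  (Subtype.mono_coe (· ∈ J)).functor ⋙ threadFunctor α ⋙ Free.embedding k (Obj Q) ⋙ I.proj

/-- `P_J`, the direct limit over `Jᵒᵖ` of the representables `Hom(j, -)`. -/
noncomputable def projRep : I.Quot ⥤ ModuleCat.{u} k :=
  colimit ((intervalFunctor I α J).op ⋙ linearCoyoneda k I.Quot)

/-- `I_J`, the pointwise dual of the direct limit over `J` of the representables `Hom(-, j)` of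
the opposite category. -/
noncomputable def injRep : I.Quot ⥤ ModuleCat.{u} k :=
  (colimit (intervalFunctor I α J ⋙ linearYoneda k I.Quot)).rightOp ⋙ dualFunctor k

end ThreadQuiver

/-! Finite-dimensionality of all values makes Fitting's lemma available, so an indecomposable `P` is
local in the sense of `HasLocalEnd`. If moreover `P` is projective and is the sum of two
subfunctors, the map from their direct sum onto `P` splits, and locality forces one of the two to be
all of `P`. This hollowness (`hollow_of_splitsEpis`) drives the proof: whenever `P` is generated by
a finite union of sets of elements, one of them suffices.

Suppose first that `P` is generated by its value at one object `X`. Then one element of that value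
generates, and splitting the surjection from `Hom(X, -)`, together with locality of `End X`, shows
that `P` is representable. Every object lies on some thread with its ends, so a singleton interval
serves.

Otherwise suppose that the values on one thread generate. Let `J` consist of the points `x` such
that the values at points `≥ x` do not generate. Modulo the subfunctor `N` generated by the value at
the target of the thread, every value on `J` comes from arbitrarily far down in `J`; since images of
finite-dimensional spaces stabilize, every element is, modulo `N`, a member of a compatible family
on `J`. By hollowness a single compatible family generates, and it gives a surjection onto `P` from
the direct limit of the `Hom(j, -)`. The surjection splits, and locality of the endomorphism ring of
the target makes it an isomorphism (`isIntervalRep_of_generates`).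

If no thread generates, the value at each point of a thread is generated from outside the thread,
hence through its source, so the vertices generate `P`. A vertex where `P` is nonzero receives
nonzero morphisms from only finitely many vertices, so hollowness singles out one generating vertex,
a contradiction.

The argument uses only the self-dual list of properties in `ThreadStructure`. The injective case is
the same theorem for the opposite category, applied to the dual of `E`. Weak admissibility enters
that list through a functor to `k` that kills the nontrivial path-like elements. -/

namespace PwfRep

variable {k : Type u} [Field k] {A : Type u} [Category.{u} A]

/-! ### Functors to vector spaces, on elements -/

section Basic

variable {M N P : A ⥤ ModuleCat.{u} k}

lemma map_id_hom (M : A ⥤ ModuleCat.{u} k) (X : A) (v : M.obj X) : (M.map (𝟙 X)).hom v = v := by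
  simp

lemma map_comp_hom (M : A ⥤ ModuleCat.{u} k) {X Y Z : A} (f : X ⟶ Y) (g : Y ⟶ Z) (v : M.obj X) :
    (M.map (f ≫ g)).hom v = (M.map g).hom ((M.map f).hom v) := by
  simp

lemma app_map_hom (φ : M ⟶ N) {X Y : A} (f : X ⟶ Y) (v : M.obj X) :
    (φ.app Y).hom ((M.map f).hom v) = (N.map f).hom ((φ.app X).hom v) :=
  congrArg (fun g => g.hom v) (φ.naturality f)

lemma app_pow_map_hom (f : P ⟶ P) {X Y : A} (g : X ⟶ Y) (n : ℕ) (v : P.obj X) :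
    ((f.app Y).hom ^ n) ((P.map g).hom v) = (P.map g).hom (((f.app X).hom ^ n) v) := by
  induction n generalizing v with
  | zero => rfl
  | succ n ih => rw [pow_succ, pow_succ, Module.End.mul_apply, Module.End.mul_apply, app_map_hom, ih]

lemma isIso_of_bijective (φ : M ⟶ N) (h : ∀ X, Function.Bijective (φ.app X).hom) : IsIso φ := by
  have : ∀ X, IsIso (φ.app X) := fun X => (ConcreteCategory.isIso_iff_bijective (φ.app X)).2 (h X)
  exact NatIso.isIso_of_isIso_app φ

lemma bijective_of_isIso (φ : M ⟶ N) [IsIso φ] (X : A) : Function.Bijective (φ.app X).hom :=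
  (ConcreteCategory.isIso_iff_bijective (φ.app X)).1 inferInstance

/-- The subfunctor given by a family of submodules that is stable under the action. -/
def restrictTo (M : A ⥤ ModuleCat.{u} k) (S : ∀ X, Submodule k (M.obj X))
    (hS : ∀ {X Y : A} (f : X ⟶ Y) {v}, v ∈ S X → (M.map f).hom v ∈ S Y) : A ⥤ ModuleCat.{u} k where
  obj X := ModuleCat.of k (S X)
  map f := ModuleCat.ofHom ((M.map f).hom.restrict fun _ hv => hS f hv)
  map_id X := by
    refine ModuleCat.hom_ext (LinearMap.ext fun v : S X => ?_)
    exact Subtype.ext (map_id_hom M X v.1)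
  map_comp {X Y Z} f g := by
    refine ModuleCat.hom_ext (LinearMap.ext fun v : S X => ?_)
    exact Subtype.ext (map_comp_hom M f g v.1)

/-- The inclusion of a subfunctor. -/
def inclusion (M : A ⥤ ModuleCat.{u} k) (S : ∀ X, Submodule k (M.obj X))
    (hS : ∀ {X Y : A} (f : X ⟶ Y) {v}, v ∈ S X → (M.map f).hom v ∈ S Y) :
    restrictTo M S hS ⟶ M where
  app X := ModuleCat.ofHom (S X).subtype

/-- The pointwise product of two functors. -/
def prodRep (M N : A ⥤ ModuleCat.{u} k) : A ⥤ ModuleCat.{u} k where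
  obj X := ModuleCat.of k (M.obj X × N.obj X)
  map f := ModuleCat.ofHom ((M.map f).hom.prodMap (N.map f).hom)
  map_id X := by
    refine ModuleCat.hom_ext (LinearMap.ext fun v : M.obj X × N.obj X => ?_)
    exact Prod.ext (map_id_hom M X v.1) (map_id_hom N X v.2)
  map_comp {X Y Z} f g := by
    refine ModuleCat.hom_ext (LinearMap.ext fun v : M.obj X × N.obj X => ?_)
    exact Prod.ext (map_comp_hom M f g v.1) (map_comp_hom N f g v.2)

/-- The first projection from the pointwise product. -/
def prodFst (M N : A ⥤ ModuleCat.{u} k) : prodRep M N ⟶ M where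
  app X := ModuleCat.ofHom (LinearMap.fst k (M.obj X) (N.obj X))

/-- The second projection from the pointwise product. -/
def prodSnd (M N : A ⥤ ModuleCat.{u} k) : prodRep M N ⟶ N where
  app X := ModuleCat.ofHom (LinearMap.snd k (M.obj X) (N.obj X))

/-- The first inclusion into the pointwise product. -/
def prodInl (M N : A ⥤ ModuleCat.{u} k) : M ⟶ prodRep M N where
  app X := ModuleCat.ofHom (LinearMap.inl k (M.obj X) (N.obj X))
  naturality X Y f := by
    ext v
    exact Prod.ext rfl (map_zero (N.map f).hom).symm

/-- The second inclusion into the pointwise product. -/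
def prodInr (M N : A ⥤ ModuleCat.{u} k) : N ⟶ prodRep M N where
  app X := ModuleCat.ofHom (LinearMap.inr k (M.obj X) (N.obj X))
  naturality X Y f := by
    ext v
    exact Prod.ext (map_zero (M.map f).hom).symm rfl

lemma prod_total (M N : A ⥤ ModuleCat.{u} k) :
    prodFst M N ≫ prodInl M N + prodSnd M N ≫ prodInr M N = 𝟙 (prodRep M N) := by
  ext X v
  exact Prod.ext (add_zero v.1) (zero_add v.2)

end Basic

/-! ### Pointwise finite-dimensional representations and Fitting's lemma -/

section Pwf

variable [Preadditive A] [Linear k A] {M N P : A ⥤ ModuleCat.{u} k}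

lemma map_add_hom (hM : isPwf k A M) {X Y : A} (f g : X ⟶ Y) (v : M.obj X) :
    (M.map (f + g)).hom v = (M.map f).hom v + (M.map g).hom v := by
  have := hM.1.1
  rw [M.map_add]; rfl

lemma map_zero_hom (hM : isPwf k A M) {X Y : A} (v : M.obj X) :
    (M.map (0 : X ⟶ Y)).hom v = 0 := by
  have := hM.1.1
  rw [M.map_zero]; rfl

lemma map_sub_hom (hM : isPwf k A M) {X Y : A} (f g : X ⟶ Y) (v : M.obj X) :
    (M.map (f - g)).hom v = (M.map f).hom v - (M.map g).hom v := by
  have := hM.1.1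
  rw [M.map_sub]; rfl

lemma map_smul_hom (hM : isPwf k A M) {X Y : A} (c : k) (f : X ⟶ Y) (v : M.obj X) :
    (M.map (c • f)).hom v = c • (M.map f).hom v := by
  have := hM.1.2
  rw [M.map_smul]; rfl

lemma isPwf_mk (M : A ⥤ ModuleCat.{u} k)
    (hadd : ∀ {X Y : A} (f g : X ⟶ Y) (v : M.obj X),
      (M.map (f + g)).hom v = (M.map f).hom v + (M.map g).hom v)
    (hsmul : ∀ {X Y : A} (c : k) (f : X ⟶ Y) (v : M.obj X),
      (M.map (c • f)).hom v = c • (M.map f).hom v)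
    (hfin : ∀ X, FiniteDimensional k (M.obj X)) : isPwf k A M :=
  ⟨⟨⟨fun {_ _ f g} => by ext v; exact hadd f g v⟩, ⟨fun f c => by ext v; exact hsmul c f v⟩⟩, hfin⟩

lemma isPwf_restrictTo (hM : isPwf k A M) (S : ∀ X, Submodule k (M.obj X))
    (hS : ∀ {X Y : A} (f : X ⟶ Y) {v}, v ∈ S X → (M.map f).hom v ∈ S Y) :
    isPwf k A (restrictTo M S hS) :=
  isPwf_mk _ (fun f g v => Subtype.ext (map_add_hom hM f g v.1))
    (fun c f v => Subtype.ext (map_smul_hom hM c f v.1)) fun X => by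
      have := hM.2 X
      exact inferInstanceAs (FiniteDimensional k (S X))

lemma isPwf_prodRep (hM : isPwf k A M) (hN : isPwf k A N) : isPwf k A (prodRep M N) :=
  isPwf_mk _ (fun f g v => Prod.ext (map_add_hom hM f g v.1) (map_add_hom hN f g v.2))
    (fun c f v => Prod.ext (map_smul_hom hM c f v.1) (map_smul_hom hN c f v.2)) fun X => by
      have := hM.2 X
      have := hN.2 X
      exact inferInstanceAs (FiniteDimensional k (M.obj X × N.obj X))

/-- The pointwise product is a biproduct of pointwise finite-dimensional representations. -/
noncomputable def prodIso (M N : RepPwf k A) :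
    (⟨prodRep M.obj N.obj, isPwf_prodRep M.property N.property⟩ : RepPwf k A) ≅ M ⊞ N :=
  let b : BinaryBicone M N :=
    { pt := ⟨prodRep M.obj N.obj, isPwf_prodRep M.property N.property⟩
      fst := ObjectProperty.homMk (prodFst M.obj N.obj)
      snd := ObjectProperty.homMk (prodSnd M.obj N.obj)
      inl := ObjectProperty.homMk (prodInl M.obj N.obj)
      inr := ObjectProperty.homMk (prodInr M.obj N.obj)
      inl_fst := by ext; rfl
      inl_snd := by ext; rfl
      inr_fst := by ext; rfl
      inr_snd := by ext; rfl }
  biprod.uniqueUpToIso M N (b := b) (isBinaryBilimitOfTotal b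
    (ObjectProperty.hom_ext _ (prod_total M.obj N.obj)))

/-- Among two endomorphisms that add up to the identity, one is invertible. -/
def HasLocalEnd (P : A ⥤ ModuleCat.{u} k) : Prop :=
  ∀ f g : P ⟶ P, f + g = 𝟙 P → IsIso f ∨ IsIso g

/-- Pointwise surjections of pointwise finite-dimensional representations onto `P` split. -/
def SplitsEpis (P : A ⥤ ModuleCat.{u} k) : Prop :=
  ∀ (M : A ⥤ ModuleCat.{u} k), isPwf k A M → ∀ π : M ⟶ P,
    (∀ X, Function.Surjective (π.app X).hom) → ∃ s : P ⟶ M, s ≫ π = 𝟙 P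

/-- Pointwise injections into pointwise finite-dimensional representations from `E` split. -/
def SplitsMonos (E : A ⥤ ModuleCat.{u} k) : Prop :=
  ∀ (M : A ⥤ ModuleCat.{u} k), isPwf k A M → ∀ ι : E ⟶ M,
    (∀ X, Function.Injective (ι.app X).hom) → ∃ r : M ⟶ E, ι ≫ r = 𝟙 E

lemma splitsEpis_of_projective (P : RepPwf k A) [Projective P] : SplitsEpis P.obj := by
  intro M hM π hπ
  let p : (⟨M, hM⟩ : RepPwf k A) ⟶ P := ObjectProperty.homMk π
  have : Epi p := ⟨fun {Z} f g h => by
    ext X v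
    obtain ⟨w, rfl⟩ := hπ X v
    exact congrArg (fun q => (q.hom.app X).hom w) h⟩
  refine ⟨(Projective.factorThru (𝟙 P) p).hom, ?_⟩
  exact congrArg (fun q => q.hom) (Projective.factorThru_comp (𝟙 P) p)

lemma splitsMonos_of_injective (E : RepPwf k A) [Injective E] : SplitsMonos E.obj := by
  intro M hM ι hι
  let i : E ⟶ (⟨M, hM⟩ : RepPwf k A) := ObjectProperty.homMk ι
  have : Mono i := ⟨fun {Z} f g h => by
    ext X v
    exact hι X (congrArg (fun q => (q.hom.app X).hom v) h)⟩
  refine ⟨(Injective.factorThru (𝟙 E) i).hom, ?_⟩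
  exact congrArg (fun q => q.hom) (Injective.comp_factorThru (𝟙 E) i)

lemma isIso_of_injective (hP : isPwf k A P) (f : P ⟶ P)
    (h : ∀ X, Function.Injective (f.app X).hom) : IsIso f := by
  refine isIso_of_bijective f fun X => ⟨h X, ?_⟩
  have := hP.2 X
  exact LinearMap.injective_iff_surjective.1 (h X)

lemma eq_zero_of_isZero {M : A ⥤ ModuleCat.{u} k} {hM : isPwf k A M}
    (h : IsZero (⟨M, hM⟩ : RepPwf k A)) {X : A} (v : M.obj X) : v = 0 := by
  have h0 : 𝟙 (⟨M, hM⟩ : RepPwf k A) = 0 := h.eq_of_src _ _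
  exact congrArg (fun q => (q.hom.app X).hom v) h0

/-- Fitting's lemma for pointwise finite-dimensional representations. -/
lemma hasLocalEnd_of_indecomposable (P : RepPwf k A) (h : Indecomposable P) :
    HasLocalEnd P.obj := by
  intro f g hfg
  have hP := P.property
  -- `R` is the eventual image and `K` the eventual kernel of `f`. They are complementary at each
  -- object, and naturality of `f` makes both subfunctors, so `P` is their direct sum.
  let R : ∀ X, Submodule k (P.obj.obj X) := fun X => ⨅ n : ℕ, LinearMap.range ((f.app X).hom ^ n)
  let K : ∀ X, Submodule k (P.obj.obj X) := fun X => ⨆ n : ℕ, LinearMap.ker ((f.app X).hom ^ n)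
  have hRK : ∀ X, IsCompl (K X) (R X) := fun X => by
    have := hP.2 X
    exact (f.app X).hom.isCompl_iSup_ker_pow_iInf_range_pow
  have hR : ∀ {X Y : A} (g : X ⟶ Y) {v}, v ∈ R X → (P.obj.map g).hom v ∈ R Y := by
    intro X Y g v hv
    simp only [R, Submodule.mem_iInf, LinearMap.mem_range] at hv ⊢
    intro n
    obtain ⟨w, rfl⟩ := hv n
    exact ⟨(P.obj.map g).hom w, app_pow_map_hom f g n w⟩
  have hK : ∀ {X Y : A} (g : X ⟶ Y) {v}, v ∈ K X → (P.obj.map g).hom v ∈ K Y := by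
    intro X Y g v hv
    have hle : K X ≤ (K Y).comap (P.obj.map g).hom := iSup_le fun n w hw => by
      refine Submodule.mem_iSup_of_mem n ?_
      rw [LinearMap.mem_ker] at hw ⊢
      rw [app_pow_map_hom, hw, map_zero]
    exact hle hv
  let φ : prodRep (restrictTo P.obj R hR) (restrictTo P.obj K hK) ⟶ P.obj :=
    prodFst _ _ ≫ inclusion _ R hR + prodSnd _ _ ≫ inclusion _ K hK
  have hφ : ∀ X (a : R X) (b : K X), (φ.app X).hom (a, b) = a.1 + b.1 := fun X a b => rfl
  have : IsIso φ := isIso_of_bijective φ fun X => by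
    constructor
    · refine (injective_iff_map_eq_zero _).2 ?_
      rintro ⟨a, b⟩ hab
      replace hab := (hφ X a b).symm.trans hab
      have ha : a.1 ∈ K X := by rw [eq_neg_of_add_eq_zero_left hab]; exact neg_mem b.2
      have ha0 := Submodule.disjoint_def.1 (hRK X).disjoint a.1 ha a.2
      have hb0 : b.1 = 0 := by simpa [ha0] using hab
      exact Prod.ext (Subtype.ext ha0) (Subtype.ext hb0)
    · intro v
      have hv : v ∈ R X ⊔ K X := by rw [sup_comm, (hRK X).sup_eq_top]; trivial
      obtain ⟨a, ha, b, hb, rfl⟩ := Submodule.mem_sup.1 hv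
      exact ⟨(⟨a, ha⟩, ⟨b, hb⟩), rfl⟩
  let YR : RepPwf k A := ⟨_, isPwf_restrictTo hP R hR⟩
  let YK : RepPwf k A := ⟨_, isPwf_restrictTo hP K hK⟩
  let e : P ≅ YR ⊞ YK := (isPwf k A).isoMk (asIso φ).symm ≪≫ prodIso YR YK
  rcases h.2 YR YK e with h0 | h0
  · right
    refine isIso_of_injective hP g fun X => (injective_iff_map_eq_zero _).2 fun v hv => ?_
    -- On the kernel of `g` the map `f = 1 - g` is the identity, so this kernel lies in the eventual
    -- image `R`, which is zero here.
    have hfv : (f.app X).hom v = v := by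
      have := congrArg (fun q => (q.app X).hom v) hfg
      change (f.app X).hom v + (g.app X).hom v = v at this
      rwa [hv, add_zero] at this
    have hn : ∀ n : ℕ, ((f.app X).hom ^ n) v = v := fun n => by
      induction n with
      | zero => rfl
      | succ n ih => rw [pow_succ, Module.End.mul_apply, hfv, ih]
    have hvR : v ∈ R X := Submodule.mem_iInf _ |>.2 fun n => ⟨v, hn n⟩
    exact congrArg Subtype.val (eq_zero_of_isZero h0 (X := X) (⟨v, hvR⟩ : R X))
  · left
    refine isIso_of_injective hP f fun X => (injective_iff_map_eq_zero _).2 fun v hv => ?_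
    have hvK : v ∈ K X := Submodule.mem_iSup_of_mem 1 (by simpa using hv)
    exact congrArg Subtype.val (eq_zero_of_isZero h0 (X := X) (⟨v, hvK⟩ : K X))

lemma exists_ne_zero_of_indecomposable (P : RepPwf k A) (h : Indecomposable P) :
    ∃ X, ∃ v : P.obj.obj X, v ≠ 0 := by
  by_contra! h0
  refine h.1 ((IsZero.iff_id_eq_zero P).2 ?_)
  ext X v
  exact (h0 X _).trans (h0 X _).symm

end Pwf

end PwfRep

/-! ### Lifting elements to inverse limits -/

/-- A functional extends along a linear map if it vanishes on the kernel. -/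
lemma Module.Dual.exists_comp_eq {k U W : Type*} [Field k] [AddCommGroup U] [Module k U] [AddCommMonoid W]
    [Module k W] (τ : U →ₗ[k] W) (e : Module.Dual k U) (h : ∀ v, τ v = 0 → e v = 0) :
    ∃ F : Module.Dual k W, F ∘ₗ τ = e := by
  let : AddCommGroup W := Module.addCommMonoidToAddCommGroup k
  have : e ∈ LinearMap.range τ.dualMap := by
    rw [LinearMap.range_dualMap_eq_dualAnnihilator_ker, Submodule.mem_dualAnnihilator]
    exact h
  exact this

/-- In an inverse system of finite-dimensional spaces over a linearly ordered set, each space has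
a stable image, all of whose elements lift to the inverse limit. -/
lemma exists_le_forall_mem_range_lift {k : Type*} [Field k] {ι : Type*} [LinearOrder ι]
    (V : ι → Type*) [∀ i, AddCommGroup (V i)] [∀ i, Module k (V i)]
    [∀ i, FiniteDimensional k (V i)] (f : ∀ i j, i ≤ j → V i →ₗ[k] V j)
    (hid : ∀ i v, f i i le_rfl v = v)
    (hcomp : ∀ i j l (hij : i ≤ j) (hjl : j ≤ l) v, f j l hjl (f i j hij v) = f i l (hij.trans hjl) v)
    (j : ι) :
    ∃ i, ∃ hij : i ≤ j, ∀ s ∈ LinearMap.range (f i j hij),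
      ∃ ℓ : ∀ i, V i, (∀ a b (hab : a ≤ b), f a b hab (ℓ a) = ℓ b) ∧ ℓ j = s := by
  classical
  -- The images in `V j` decrease as the index does; where the rank is minimal the image is
  -- contained in all the others.
  let r : Set.Iic j → ℕ := fun i => Module.finrank k (LinearMap.range (f i j i.2))
  have : Nonempty (Set.Iic j) := ⟨⟨j, le_rfl⟩⟩
  let i := Function.argmin r
  refine ⟨i, i.2, fun s hs => ?_⟩
  have hle : ∀ a b (hab : a ≤ b) (hb : b ≤ j),
      LinearMap.range (f a j (hab.trans hb)) ≤ LinearMap.range (f b j hb) := by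
    rintro a b hab hb _ ⟨v, rfl⟩
    exact ⟨f a b hab v, hcomp a b j hab hb v⟩
  have hs' : ∀ a (ha : a ≤ j), s ∈ LinearMap.range (f a j ha) := by
    intro a ha
    rcases le_total (i : ι) a with h | h
    · exact hle i a h ha hs
    · have := Submodule.eq_of_le_of_finrank_le (hle a i h i.2) (Function.argmin_le r ⟨a, ha⟩)
      rwa [this]
  -- An element of the inverse limit is the same as a functional on the direct limit of the duals,
  -- because each `V a` is its own double dual.
  let G : ιᵒᵈ → Type _ := fun a => Module.Dual k (V (OrderDual.ofDual a))
  let φ : ∀ a b : ιᵒᵈ, a ≤ b → G a →ₗ[k] G b := fun a b hab =>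
    (f (OrderDual.ofDual b) (OrderDual.ofDual a) hab).dualMap
  have : DirectedSystem G fun a b hab => φ a b hab :=
    { map_self := fun a v => LinearMap.ext fun x => congrArg v (hid _ x)
      map_map := fun a b c hab hbc v => LinearMap.ext fun x => congrArg v (hcomp _ _ _ hbc hab x) }
  let of : ∀ a : ι, Module.Dual k (V a) →ₗ[k] Module.DirectLimit G φ := fun a =>
    Module.DirectLimit.of k ιᵒᵈ G φ (OrderDual.toDual a)
  have hof : ∀ a b (hab : a ≤ b) (v : Module.Dual k (V b)), of a (v ∘ₗ f a b hab) = of b v :=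
    fun a b hab v => Module.DirectLimit.of_f (f := φ) (i := OrderDual.toDual b)
      (j := OrderDual.toDual a) (hij := hab) (x := v)
  -- Evaluation at `s` descends to the image of the dual of `V j` in the direct limit: a functional
  -- that dies there vanishes on the image of some `V a`, and that image contains `s`.
  obtain ⟨F, hF⟩ := Module.Dual.exists_comp_eq (of j) (Module.Dual.eval k (V j) s) fun v hv => by
    have : Nonempty ιᵒᵈ := ⟨OrderDual.toDual j⟩
    obtain ⟨a, ha, h0⟩ := Module.DirectLimit.of.zero_exact (R := k) (f := φ) hv
    obtain ⟨x, hx⟩ := hs' (OrderDual.ofDual a) ha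
    exact (congrArg v hx).symm.trans (LinearMap.congr_fun h0 x)
  refine ⟨fun a => (Module.evalEquiv k (V a)).symm (F ∘ₗ of a), fun a b hab => ?_, ?_⟩
  · apply (Module.evalEquiv k (V b)).injective
    rw [LinearEquiv.apply_symm_apply]
    ext v
    rw [Module.evalEquiv_apply]
    have := LinearMap.congr_fun ((Module.evalEquiv k (V a)).apply_symm_apply (F ∘ₗ of a))
      (v ∘ₗ f a b hab)
    rw [Module.evalEquiv_apply] at this
    exact this.trans (congrArg F (hof a b hab v))
  · apply (Module.evalEquiv k (V j)).injective
    rw [LinearEquiv.apply_symm_apply]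
    exact hF

/-! ### Generating sets and hollow functors -/

namespace PwfRep

variable {k : Type u} [Field k] {A : Type u} [Category.{u} A] {P : A ⥤ ModuleCat.{u} k}

/-- The value at `X` of the subfunctor generated by a set `G` of elements. -/
def genSub (P : A ⥤ ModuleCat.{u} k) (G : Set (Σ X, P.obj X)) (X : A) : Submodule k (P.obj X) :=
  Submodule.span k {w | ∃ g ∈ G, ∃ f : g.1 ⟶ X, w = (P.map f).hom g.2}

/-- The set `G` generates the functor `P`. -/
def Generates (P : A ⥤ ModuleCat.{u} k) (G : Set (Σ X, P.obj X)) : Prop :=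
  ∀ X, genSub P G X = ⊤

/-- All elements of `P` at the objects in `S`. -/
def elementsAt (P : A ⥤ ModuleCat.{u} k) (S : Set A) : Set (Σ X, P.obj X) := {g | g.1 ∈ S}

lemma elementsAt_union (P : A ⥤ ModuleCat.{u} k) (S S' : Set A) :
    elementsAt P (S ∪ S') = elementsAt P S ∪ elementsAt P S' := rfl

lemma elementsAt_mono (P : A ⥤ ModuleCat.{u} k) {S S' : Set A} (h : S ⊆ S') :
    elementsAt P S ⊆ elementsAt P S' := fun _ hg => h hg

lemma map_mem_genSub_of_mem {G : Set (Σ X, P.obj X)} {X Y : A} (f : X ⟶ Y) {v : P.obj X}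
    (hv : (⟨X, v⟩ : Σ X, P.obj X) ∈ G) : (P.map f).hom v ∈ genSub P G Y :=
  Submodule.subset_span ⟨_, hv, f, rfl⟩

lemma mem_genSub_of_mem {G : Set (Σ X, P.obj X)} {X : A} {v : P.obj X}
    (hv : (⟨X, v⟩ : Σ X, P.obj X) ∈ G) : v ∈ genSub P G X := by
  simpa using map_mem_genSub_of_mem (𝟙 X) hv

lemma map_mem_genSub {G : Set (Σ X, P.obj X)} {X Y : A} (f : X ⟶ Y) {v : P.obj X}
    (hv : v ∈ genSub P G X) : (P.map f).hom v ∈ genSub P G Y := by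
  have hle : genSub P G X ≤ (genSub P G Y).comap (P.map f).hom := by
    refine Submodule.span_le.2 ?_
    rintro _ ⟨g, hg, h, rfl⟩
    rw [SetLike.mem_coe, Submodule.mem_comap, ← map_comp_hom]
    exact map_mem_genSub_of_mem _ hg
  exact hle hv

lemma genSub_le {G G' : Set (Σ X, P.obj X)} (h : ∀ g ∈ G, g.2 ∈ genSub P G' g.1) (X : A) :
    genSub P G X ≤ genSub P G' X := by
  refine Submodule.span_le.2 ?_
  rintro _ ⟨g, hg, f, rfl⟩
  exact map_mem_genSub f (h g hg)

lemma Generates.of_forall_mem {G G' : Set (Σ X, P.obj X)} (hG : Generates P G)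
    (h : ∀ g ∈ G, g.2 ∈ genSub P G' g.1) : Generates P G' :=
  fun X => top_le_iff.1 ((hG X).ge.trans (genSub_le h X))

lemma Generates.mono {G G' : Set (Σ X, P.obj X)} (hG : Generates P G) (h : G ⊆ G') :
    Generates P G' :=
  hG.of_forall_mem fun _ hg => mem_genSub_of_mem (h hg)

lemma Generates.mem {G : Set (Σ X, P.obj X)} (hG : Generates P G) {X : A} (v : P.obj X) :
    v ∈ genSub P G X := by
  rw [hG X]; trivial

lemma genSub_union (G G' : Set (Σ X, P.obj X)) (X : A) :
    genSub P (G ∪ G') X = genSub P G X ⊔ genSub P G' X := by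
  rw [genSub, genSub, genSub, ← Submodule.span_union]
  congr 1
  ext w
  constructor
  · rintro ⟨g, hg | hg, f, rfl⟩
    exacts [Or.inl ⟨g, hg, f, rfl⟩, Or.inr ⟨g, hg, f, rfl⟩]
  · rintro (⟨g, hg, f, rfl⟩ | ⟨g, hg, f, rfl⟩)
    exacts [⟨g, Or.inl hg, f, rfl⟩, ⟨g, Or.inr hg, f, rfl⟩]

lemma eq_zero_of_generates_zero {G : Set (Σ X, P.obj X)} (hG : Generates P G)
    {X : A} (h : ∀ g ∈ G, ∀ f : g.1 ⟶ X, (P.map f).hom g.2 = 0) (v : P.obj X) : v = 0 := by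
  have hv := hG.mem v
  have hle : genSub P G X ≤ ⊥ := by
    refine Submodule.span_le.2 ?_
    rintro _ ⟨g, hg, f, rfl⟩
    exact h g hg f
  exact (Submodule.mem_bot k).1 (hle hv)

/-- A functor is hollow if it is not the sum of two proper subfunctors. -/
def Hollow (P : A ⥤ ModuleCat.{u} k) : Prop :=
  ∀ G G' : Set (Σ X, P.obj X), Generates P (G ∪ G') → Generates P G ∨ Generates P G'

lemma Hollow.exists_of_finite (hP : Hollow P) (h0 : ¬ Generates P ∅) {ι : Type*} {s : Set ι}
    (hs : s.Finite) (G : ι → Set (Σ X, P.obj X)) (h : Generates P (⋃ i ∈ s, G i)) :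
    ∃ i ∈ s, Generates P (G i) := by
  induction s, hs using Set.Finite.induction_on with
  | empty => simp only [Set.biUnion_empty] at h; exact absurd h h0
  | insert _ _ ih =>
    rw [Set.biUnion_insert] at h
    rcases hP _ _ h with h | h
    · exact ⟨_, Or.inl rfl, h⟩
    · obtain ⟨i, hi, h⟩ := ih h
      exact ⟨i, Or.inr hi, h⟩

/-- The external direct sum of the two generated subfunctors maps onto `P`. A section writes the
identity as a sum of two endomorphisms, one through each subfunctor; the invertible one has image
all of `P`. -/
lemma hollow_of_splitsEpis [Preadditive A] [Linear k A] (hP : isPwf k A P) (hs : SplitsEpis P)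
    (hl : HasLocalEnd P) : Hollow P := by
  intro G G' h
  have hm : ∀ (G : Set (Σ X, P.obj X)) {X Y : A} (f : X ⟶ Y) {v}, v ∈ genSub P G X →
      (P.map f).hom v ∈ genSub P G Y := fun G _ _ f _ hv => map_mem_genSub f hv
  let π₁ := prodFst (restrictTo P (genSub P G) (hm G)) (restrictTo P (genSub P G') (hm G')) ≫
    inclusion P _ (hm G)
  let π₂ := prodSnd (restrictTo P (genSub P G) (hm G)) (restrictTo P (genSub P G') (hm G')) ≫
    inclusion P _ (hm G')
  obtain ⟨s, hs⟩ := hs _ (isPwf_prodRep (isPwf_restrictTo hP _ (hm G))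
    (isPwf_restrictTo hP _ (hm G'))) (π₁ + π₂) fun X v => by
      have hv := h.mem v
      rw [genSub_union] at hv
      obtain ⟨a, ha, b, hb, rfl⟩ := Submodule.mem_sup.1 hv
      exact ⟨(⟨a, ha⟩, ⟨b, hb⟩), rfl⟩
  rw [Preadditive.comp_add] at hs
  rcases hl _ _ hs with h | h
  · refine Or.inl fun X => top_le_iff.1 fun v _ => ?_
    obtain ⟨w, rfl⟩ := (bijective_of_isIso (s ≫ π₁) X).2 v
    exact (show genSub P G X × genSub P G' X from (s.app X).hom w).1.2
  · refine Or.inr fun X => top_le_iff.1 fun v _ => ?_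
    obtain ⟨w, rfl⟩ := (bijective_of_isIso (s ≫ π₂) X).2 v
    exact (show genSub P G X × genSub P G' X from (s.app X).hom w).2.2

/-- A hollow functor that is generated by one of its spaces is generated by one element. -/
lemma Hollow.exists_element (hP : Hollow P) (h0 : ¬ Generates P ∅) {X : A}
    [FiniteDimensional k (P.obj X)] (h : Generates P (elementsAt P {X})) :
    ∃ v : P.obj X, Generates P {⟨X, v⟩} := by
  obtain ⟨s, hs⟩ := (Module.Finite.fg_top : (⊤ : Submodule k (P.obj X)).FG)
  have h' : Generates P (⋃ v ∈ (s : Set (P.obj X)), {⟨X, v⟩}) := by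
    refine h.of_forall_mem ?_
    rintro ⟨Y, v⟩ (rfl : Y = X)
    have hv : v ∈ Submodule.span k (s : Set (P.obj Y)) := by rw [hs]; trivial
    refine Submodule.span_le.2 (fun w hw => ?_) hv
    exact mem_genSub_of_mem (Set.mem_biUnion hw rfl)
  obtain ⟨v, -, hv⟩ := hP.exists_of_finite h0 s.finite_toSet _ h'
  exact ⟨v, hv⟩

end PwfRep

/-! ### Thread structures -/

/-- The structure on the objects and morphisms of a `k`-linear category `A` that it inherits from
a thread quiver: threads of objects `pt α x`, each with a source `src α` and a target `tgt α`, such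
that all morphisms between different threads pass through the ends of the threads. -/
structure ThreadStructure (k : Type u) [Field k] (A : Type u) [Category.{u} A] [Preadditive A]
    [Linear k A] where
  /-- the vertices -/
  vertices : Set A
  /-- the arrows -/
  Arrow : Type u
  /-- the thread of an arrow -/
  Thread : Arrow → Type u
  [order : ∀ α, LinearOrder (Thread α)]
  /-- the source of an arrow -/
  src : Arrow → A
  /-- the target of an arrow -/
  tgt : Arrow → A
  /-- the objects on a thread -/
  pt : ∀ α, Thread α → A
  /-- the transition morphisms of a thread -/
  η : ∀ {α} {x y : Thread α}, x ≤ y → (pt α x ⟶ pt α y)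
  /-- the morphism from the source to a point -/
  ηs : ∀ {α} (x : Thread α), src α ⟶ pt α x
  /-- the morphism from a point to the target -/
  ηt : ∀ {α} (x : Thread α), pt α x ⟶ tgt α
  η_refl : ∀ {α} (x : Thread α), η (le_refl x) = 𝟙 _
  η_comp : ∀ {α} {x y z : Thread α} (h : x ≤ y) (h' : y ≤ z), η h ≫ η h' = η (h.trans h')
  ηs_comp : ∀ {α} {x y : Thread α} (h : x ≤ y), ηs x ≫ η h = ηs y
  comp_ηt : ∀ {α} {x y : Thread α} (h : x ≤ y), η h ≫ ηt y = ηt x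
  src_mem : ∀ α, src α ∈ vertices
  tgt_mem : ∀ α, tgt α ∈ vertices
  cover : ∀ X, X ∈ vertices ∨ ∃ α, X ∈ Set.range (pt α)
  notMem_range : ∀ α, ∀ X ∈ vertices, X ∉ Set.range (pt α)
  factor_src : ∀ α, ∀ X ∉ Set.range (pt α), ∀ (y : Thread α) (f : X ⟶ pt α y),
    ∃ g : X ⟶ src α, f = g ≫ ηs y
  factor_tgt : ∀ α, ∀ X ∉ Set.range (pt α), ∀ (y : Thread α) (f : pt α y ⟶ X),
    ∃ g : tgt α ⟶ X, f = ηt y ≫ g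
  hom_pt : ∀ {α} {x y : Thread α} (f : pt α x ⟶ pt α y), ∃ g : tgt α ⟶ src α,
    f = ηt x ≫ g ≫ ηs y ∨ ∃ (h : x ≤ y) (c : k), f = c • η h + ηt x ≫ g ≫ ηs y
  not_isIso_tgt : ∀ {α} (x : Thread α) (g : tgt α ⟶ src α), ¬ IsIso (g ≫ ηs x ≫ ηt x)
  not_isIso_src : ∀ {α} (x : Thread α) (g : tgt α ⟶ src α), ¬ IsIso (ηs x ≫ ηt x ≫ g)

namespace ThreadStructure

attribute [instance] ThreadStructure.order

variable {k : Type u} [Field k] {A : Type u} [Category.{u} A] [Preadditive A] [Linear k A]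
  (T : ThreadStructure k A) {α : T.Arrow} (J : Set (T.Thread α))

open PwfRep

/-! ### Direct limits of representables along a thread -/

section LimRep

/-- The transition maps between the spaces `Hom(j, X)`. -/
abbrev limTransition (X : A) (i j : Jᵒᵈ) (h : i ≤ j) :
    (T.pt α (OrderDual.ofDual i : J) ⟶ X) →ₗ[k] (T.pt α (OrderDual.ofDual j : J) ⟶ X) :=
  Linear.leftComp k X (T.η (α := α) h)

open Classical in
/-- The direct limit of the representable functors `Hom(j, -)` for `j` in `J`, `j` decreasing. -/
noncomputable def limRep : A ⥤ ModuleCat.{u} k where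
  obj X := ModuleCat.of k (Module.DirectLimit _ (T.limTransition J X))
  map {X Y} f := ModuleCat.ofHom (Module.DirectLimit.map (f := T.limTransition J X)
    (f' := T.limTransition J Y) (fun _ => Linear.rightComp k _ f)
    (fun _ _ h => LinearMap.ext fun g => (Category.assoc _ g f)))
  map_id X := by
    refine ModuleCat.hom_ext (Module.DirectLimit.hom_ext fun j => LinearMap.ext fun g => ?_)
    simp
  map_comp f g := by
    refine ModuleCat.hom_ext (Module.DirectLimit.hom_ext fun j => LinearMap.ext fun g => ?_)
    simp

variable {J}

open Classical in
/-- The map from `Hom(j, -)` to the direct limit. -/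
noncomputable def limOf (j : J) (X : A) : (T.pt α j ⟶ X) →ₗ[k] (T.limRep J).obj X :=
  Module.DirectLimit.of k Jᵒᵈ _ (T.limTransition J X) (OrderDual.toDual j)

lemma limRep_map_limOf (j : J) {X Y : A} (f : T.pt α j ⟶ X) (g : X ⟶ Y) :
    ((T.limRep J).map g).hom (T.limOf j X f) = T.limOf j Y (f ≫ g) := by
  classical
  exact Module.DirectLimit.map_apply_of (f := T.limTransition J X) (f' := T.limTransition J Y)
    (fun _ => Linear.rightComp k _ g)
    (fun _ _ _ => LinearMap.ext fun _ => (Category.assoc _ _ _)) (i := OrderDual.toDual j) f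

lemma limOf_η {i j : J} (h : (i : T.Thread α) ≤ j) {X : A} (f : T.pt α j ⟶ X) :
    T.limOf i X (T.η h ≫ f) = T.limOf j X f :=
  Module.DirectLimit.of_f (f := T.limTransition J X) (i := OrderDual.toDual j)
    (j := OrderDual.toDual i) (hij := h) (x := f)

lemma limOf_eq (j : J) {X : A} (f : T.pt α j ⟶ X) :
    T.limOf j X f = ((T.limRep J).map f).hom (T.limOf j _ (𝟙 _)) := by
  rw [limRep_map_limOf, Category.id_comp]

lemma exists_limOf [Nonempty J] {X : A} (v : (T.limRep J).obj X) :
    ∃ (j : J) (f : T.pt α j ⟶ X), T.limOf j X f = v := by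
  have : Nonempty Jᵒᵈ := ‹Nonempty J›
  obtain ⟨j, f, h⟩ := Module.DirectLimit.exists_of (f := T.limTransition J X) v
  exact ⟨OrderDual.ofDual j, f, h⟩

lemma limOf_eq_zero [Nonempty J] {X : A} {j : J} {f : T.pt α j ⟶ X} (h : T.limOf j X f = 0) :
    ∃ (i : J) (hij : (i : T.Thread α) ≤ j), T.η hij ≫ f = 0 := by
  have : Nonempty Jᵒᵈ := ‹Nonempty J›
  have : DirectedSystem _ fun i j h => T.limTransition J X i j h :=
    { map_self := fun j g => by
        change T.η _ ≫ g = g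
        rw [T.η_refl, Category.id_comp]
      map_map := fun a b c hab hbc g => by
        exact (Category.assoc _ _ _).symm.trans (congrArg (· ≫ g) (T.η_comp (α := α) hbc hab)) }
  obtain ⟨i, hij, h0⟩ := Module.DirectLimit.of.zero_exact (f := T.limTransition J X) h
  exact ⟨OrderDual.ofDual i, hij, h0⟩

section Lift

variable {M : A ⥤ ModuleCat.{u} k} (hM : isPwf k A M) (ℓ : ∀ j : J, M.obj (T.pt α j))
  (hℓ : ∀ (i j : J) (h : (i : T.Thread α) ≤ j), (M.map (T.η h)).hom (ℓ i) = ℓ j)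

open Classical in
/-- The value at `X` of the morphism from the direct limit given by a compatible family. -/
noncomputable def limLiftApp (X : A) : (T.limRep J).obj X →ₗ[k] M.obj X :=
  Module.DirectLimit.lift k Jᵒᵈ _ (T.limTransition J X)
    (fun j => { toFun := fun f => (M.map f).hom (ℓ (OrderDual.ofDual j))
                map_add' := fun f g => map_add_hom hM f g _
                map_smul' := fun c f => map_smul_hom hM c f _ })
    (fun _ _ h f => (map_comp_hom M _ f _).trans (congrArg (M.map f).hom (hℓ _ _ h)))

lemma limLiftApp_limOf (j : J) {X : A} (f : T.pt α j ⟶ X) :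
    T.limLiftApp hM ℓ hℓ X (T.limOf j X f) = (M.map f).hom (ℓ j) := by
  classical
  exact Module.DirectLimit.lift_of (f := T.limTransition J X) (i := OrderDual.toDual j) _
    (fun _ _ h f => (map_comp_hom M _ f _).trans (congrArg (M.map f).hom (hℓ _ _ h))) f

/-- The morphism from the direct limit given by a compatible family of elements. -/
noncomputable def limLift : T.limRep J ⟶ M where
  app X := ModuleCat.ofHom (T.limLiftApp hM ℓ hℓ X)
  naturality X Y f := by
    refine ModuleCat.hom_ext (Module.DirectLimit.hom_ext fun j => LinearMap.ext fun g => ?_)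
    change T.limLiftApp hM ℓ hℓ Y (((T.limRep J).map f).hom (T.limOf (OrderDual.ofDual j) X g)) =
      (M.map f).hom (T.limLiftApp hM ℓ hℓ X (T.limOf (OrderDual.ofDual j) X g))
    rw [limRep_map_limOf, limLiftApp_limOf, limLiftApp_limOf, map_comp_hom]

lemma limLift_limOf (j : J) {X : A} (f : T.pt α j ⟶ X) :
    ((T.limLift hM ℓ hℓ).app X).hom (T.limOf j X f) = (M.map f).hom (ℓ j) :=
  T.limLiftApp_limOf hM ℓ hℓ j f

end Lift

/-- The points of `J` are comparable and the transition morphisms commute with the morphisms to the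
target, so a morphism out of the target has one class, whichever point it is pulled back to. -/
lemma limOf_ηt (i j : J) {X : A} (f : T.tgt α ⟶ X) :
    T.limOf i X (T.ηt i.1 ≫ f) = T.limOf j X (T.ηt j.1 ≫ f) := by
  rcases le_total (i : T.Thread α) j with h | h
  · rw [← T.limOf_η h, ← Category.assoc, T.comp_ηt]
  · rw [← T.limOf_η h, ← Category.assoc, T.comp_ηt]

lemma limOf_η_eq (i j : J) {y : T.Thread α} (hi : (i : T.Thread α) ≤ y)
    (hj : (j : T.Thread α) ≤ y) : T.limOf i _ (T.η hi) = T.limOf j _ (T.η hj) := by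
  rcases le_total (i : T.Thread α) j with h | h
  · rw [← T.limOf_η h, T.η_comp]
  · rw [← T.limOf_η h, T.η_comp]

/-- The classes of morphisms through the target form a quotient of one finite-dimensional space, and
the transition morphisms contribute at most one further dimension. -/
lemma isPwf_limRep (hfin : ∀ X Y : A, FiniteDimensional k (X ⟶ Y)) [Nonempty J] :
    isPwf k A (T.limRep J) := by
  refine isPwf_mk _ (fun f g v => ?_) (fun c f v => ?_) fun X => ?_
  · obtain ⟨j, h, rfl⟩ := T.exists_limOf v
    rw [limRep_map_limOf, limRep_map_limOf, limRep_map_limOf, Preadditive.comp_add, map_add]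
  · obtain ⟨j, h, rfl⟩ := T.exists_limOf v
    rw [limRep_map_limOf, limRep_map_limOf, Linear.comp_smul, map_smul]
  · obtain ⟨j₀⟩ := ‹Nonempty J›
    have := hfin (T.tgt α) X
    let τ : (T.tgt α ⟶ X) →ₗ[k] (T.limRep J).obj X := T.limOf j₀ X ∘ₗ Linear.leftComp k X (T.ηt j₀.1)
    have hτ : ∀ (j : J) g, T.limOf j X (T.ηt j.1 ≫ g) ∈ LinearMap.range τ := fun j g =>
      ⟨g, T.limOf_ηt j₀ j g⟩
    suffices h : ∃ u : (T.limRep J).obj X, ∀ v, v ∈ LinearMap.range τ ⊔ Submodule.span k {u} by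
      obtain ⟨u, hu⟩ := h
      have : (⊤ : Submodule k ((T.limRep J).obj X)) = LinearMap.range τ ⊔ Submodule.span k {u} :=
        (top_le_iff.1 fun v _ => hu v).symm
      have hr : (LinearMap.range τ).FG := Module.Finite.iff_fg.1 (Module.Finite.range τ)
      exact ⟨this ▸ hr.sup (Submodule.fg_span_singleton u)⟩
    by_cases hX : X ∈ Set.range (T.pt α)
    · obtain ⟨y, rfl⟩ := hX
      obtain ⟨u, hu⟩ : ∃ u, ∀ (j : J) (h : (j : T.Thread α) ≤ y), T.limOf j _ (T.η h) = u := by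
        by_cases h : ∃ j : J, (j : T.Thread α) ≤ y
        · obtain ⟨i, hi⟩ := h
          exact ⟨_, fun j hj => T.limOf_η_eq j i hj hi⟩
        · exact ⟨0, fun j hj => absurd ⟨j, hj⟩ h⟩
      refine ⟨u, fun v => ?_⟩
      obtain ⟨j, f, rfl⟩ := T.exists_limOf v
      obtain ⟨g, rfl | ⟨h, c, rfl⟩⟩ := T.hom_pt f
      · exact Submodule.mem_sup_left (hτ j _)
      · rw [map_add, map_smul, hu]
        exact add_mem (Submodule.mem_sup_right (Submodule.smul_mem _ _
          (Submodule.mem_span_singleton_self u))) (Submodule.mem_sup_left (hτ j _))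
    · refine ⟨0, fun v => ?_⟩
      obtain ⟨j, f, rfl⟩ := T.exists_limOf v
      obtain ⟨g, rfl⟩ := T.factor_tgt α X hX _ f
      exact Submodule.mem_sup_left (hτ j g)

end LimRep

/-- The functor `P` is the direct limit of the functors `Hom(j, -)` for `j` in `J`. -/
def IsIntervalRep (P : A ⥤ ModuleCat.{u} k) : Prop :=
  ∃ ℓ : ∀ j : J, P.obj (T.pt α j),
    (∀ (i j : J) (h : (i : T.Thread α) ≤ j), (P.map (T.η h)).hom (ℓ i) = ℓ j) ∧
    (∀ (X : A) (v : P.obj X), ∃ (j : J) (f : T.pt α j ⟶ X), (P.map f).hom (ℓ j) = v) ∧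
    ∀ (j : J) (X : A) (f : T.pt α j ⟶ X), (P.map f).hom (ℓ j) = 0 →
      ∃ (i : J) (h : (i : T.Thread α) ≤ j), T.η h ≫ f = 0

end ThreadStructure

/-! ### Representable functors -/

namespace PwfRep

variable {k : Type u} [Field k] {A : Type u} [Category.{u} A]

lemma eq_zero_of_map_eq_zero {P : A ⥤ ModuleCat.{u} k} {X Y : A} (f : X ⟶ Y) [IsIso f] {v : P.obj X}
    (h : (P.map f).hom v = 0) : v = 0 := by
  rw [← map_id_hom P X v, ← IsIso.hom_inv_id f, map_comp_hom, h, map_zero]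

variable [Preadditive A] [Linear k A]

lemma isIso_or_isIso_one_sub {X : A} (hX : IsLocalRing (End X)) (r : X ⟶ X) :
    IsIso r ∨ IsIso (𝟙 X - r) := by
  have h := hX.isUnit_or_isUnit_of_add_one (a := (r : End X)) (b := (𝟙 X - r : X ⟶ X))
    (add_sub_cancel r (𝟙 X))
  rwa [isUnit_iff_isIso, isUnit_iff_isIso] at h

/-- The functor `P` is represented by the object `X`. -/
def IsRepresentedBy (P : A ⥤ ModuleCat.{u} k) (X : A) : Prop :=
  ∃ v : P.obj X, (∀ (Y : A) (w : P.obj Y), ∃ f : X ⟶ Y, (P.map f).hom v = w) ∧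
    ∀ (Y : A) (f : X ⟶ Y), (P.map f).hom v = 0 → f = 0

/-- The functor represented by `X`. -/
abbrev hom (k : Type u) [Field k] {A : Type u} [Category.{u} A] [Preadditive A] [Linear k A]
    (X : A) : A ⥤ ModuleCat.{u} k := (linearCoyoneda k A).obj (Opposite.op X)

lemma isPwf_hom (hfin : ∀ X Y : A, FiniteDimensional k (X ⟶ Y)) (X : A) : isPwf k A (hom k X) :=
  isPwf_mk _ (fun f g (v : X ⟶ _) => Preadditive.comp_add _ _ _ v f g)
    (fun c f (v : X ⟶ _) => Linear.comp_smul _ _ _ v c f) fun Y => hfin X Y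

/-- The morphism from a representable functor given by an element. -/
def homLift {P : A ⥤ ModuleCat.{u} k} (hP : isPwf k A P) {X : A} (v : P.obj X) : hom k X ⟶ P where
  app Y := ModuleCat.ofHom
    { toFun := fun f : X ⟶ Y => (P.map f).hom v
      map_add' := fun f g => map_add_hom hP f g v
      map_smul' := fun c f => map_smul_hom hP c f v }
  naturality Y Z f := by
    refine ModuleCat.hom_ext (LinearMap.ext fun g : X ⟶ Y => ?_)
    exact map_comp_hom P g f v

lemma exists_map_eq_of_generates {P : A ⥤ ModuleCat.{u} k} (hP : isPwf k A P) {X : A} {v : P.obj X}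
    (h : Generates P {⟨X, v⟩}) {Y : A} (w : P.obj Y) : ∃ f : X ⟶ Y, (P.map f).hom v = w := by
  have hle : genSub P {⟨X, v⟩} Y ≤ LinearMap.range ((homLift hP v).app Y).hom := by
    refine Submodule.span_le.2 ?_
    rintro _ ⟨_, rfl, f, rfl⟩
    exact ⟨f, rfl⟩
  exact hle (h.mem w)

/-- A section of `Hom(X, -) → P` sends the generator `v` to an endomorphism `r` of `X` that fixes
`v`. In a local ring `r` or `1 - r` is invertible. The second would give `v = 0`; the first makes
the surjection injective. -/
lemma isRepresentedBy_of_generates {P : A ⥤ ModuleCat.{u} k}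
    (hfin : ∀ X Y : A, FiniteDimensional k (X ⟶ Y)) {X : A} (hX : IsLocalRing (End X))
    (hP : isPwf k A P) (hs : SplitsEpis P) (h0 : ¬ Generates P ∅) {v : P.obj X}
    (h : Generates P {⟨X, v⟩}) : IsRepresentedBy P X := by
  refine ⟨v, fun Y w => exists_map_eq_of_generates hP h w, fun Y f hf => ?_⟩
  obtain ⟨s, hs⟩ := hs _ (isPwf_hom hfin X) (homLift hP v)
    fun Y w => exists_map_eq_of_generates hP h w
  let r : X ⟶ X := (s.app X).hom v
  have hr : (P.map r).hom v = v := congrArg (fun q => (q.app X).hom v) hs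
  rcases isIso_or_isIso_one_sub hX r with h1 | h1
  · have h2 : r ≫ f = 0 := (app_map_hom s f v).symm.trans (by rw [hf]; exact map_zero _)
    rw [← cancel_epi r, h2, comp_zero]
  · have hv : v = 0 := eq_zero_of_map_eq_zero (𝟙 X - r) (by
      rw [map_sub_hom hP, map_id_hom, hr, sub_self])
    refine absurd (h.of_forall_mem ?_) h0
    rintro _ rfl
    exact hv ▸ zero_mem _

end PwfRep

/-! ### Classification over a thread structure -/

namespace ThreadStructure

variable {k : Type u} [Field k] {A : Type u} [Category.{u} A] [Preadditive A] [Linear k A]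
  (T : ThreadStructure k A) {α : T.Arrow} {J : Set (T.Thread α)} {P : A ⥤ ModuleCat.{u} k}

open PwfRep

/-- The elements that form a family indexed by `J`. -/
def familySet (ℓ : ∀ j : J, P.obj (T.pt α j)) : Set (Σ X, P.obj X) :=
  Set.range fun j : J => ⟨T.pt α j, ℓ j⟩

lemma map_through_mem {x y : T.Thread α} (g : T.tgt α ⟶ T.src α) (v : P.obj (T.pt α x)) :
    (P.map (T.ηt x ≫ g ≫ T.ηs y)).hom v ∈ genSub P (elementsAt P {T.tgt α}) (T.pt α y) := by
  rw [map_comp_hom]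
  exact map_mem_genSub_of_mem _ rfl

/-- The family gives a surjection `π` from the direct limit to `P`, with a section `s`. The
idempotent `1 - π ≫ s` has image the kernel of `π`; it is shown to kill the class of every identity
morphism, and these classes generate the direct limit. -/
lemma isIntervalRep_of_generates (hfin : ∀ X Y : A, FiniteDimensional k (X ⟶ Y))
    (hloc : IsLocalRing (End (T.tgt α))) (hP : isPwf k A P) (hs : SplitsEpis P) [Nonempty J]
    (ht : ¬ Generates P (elementsAt P {T.tgt α})) (ℓ : ∀ j : J, P.obj (T.pt α j))
    (hℓ : ∀ (i j : J) (h : (i : T.Thread α) ≤ j), (P.map (T.η h)).hom (ℓ i) = ℓ j)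
    (hgen : Generates P (T.familySet ℓ)) : T.IsIntervalRep J P := by
  let π := T.limLift hP ℓ hℓ
  have hπ : ∀ (j : J) {X : A} (f : T.pt α j ⟶ X),
      (π.app X).hom (T.limOf j X f) = (P.map f).hom (ℓ j) :=
    fun j _ f => T.limLift_limOf hP ℓ hℓ j f
  have hπ1 : ∀ j : J, (π.app _).hom (T.limOf j _ (𝟙 _)) = ℓ j := fun j => by
    rw [hπ, map_id_hom]
  obtain ⟨s, hsπ⟩ := hs _ (T.isPwf_limRep hfin) π fun X v => by
    have hle : genSub P (T.familySet ℓ) X ≤ LinearMap.range (π.app X).hom := by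
      refine Submodule.span_le.2 ?_
      rintro _ ⟨_, ⟨j, rfl⟩, f, rfl⟩
      exact ⟨_, hπ j f⟩
    exact hle (hgen.mem v)
  have hsπ' : ∀ {X : A} (v : P.obj X), (π.app X).hom ((s.app X).hom v) = v := fun {X} v =>
    congrArg (fun q => (q.app X).hom v) hsπ
  let N := genSub P (elementsAt P {T.tgt α})
  -- Membership in `N` propagates upwards along the family. Were there members in `N` arbitrarily
  -- far down, all would be in `N` and the value at the target would generate `P`.
  obtain ⟨j₀, hj₀⟩ : ∃ j₀ : J, ∀ j : J, (j : T.Thread α) ≤ j₀ → ℓ j ∉ N (T.pt α j) := by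
    by_contra! hcon
    refine ht (hgen.of_forall_mem ?_)
    rintro _ ⟨j, rfl⟩
    obtain ⟨i, hij, hi⟩ := hcon j
    change ℓ j ∈ N _
    rw [← hℓ i j hij]
    exact map_mem_genSub _ hi
  let e : T.limRep J ⟶ T.limRep J := 𝟙 _ - π ≫ s
  have he : ∀ {X : A} (v : (T.limRep J).obj X),
      (e.app X).hom v = v - (s.app X).hom ((π.app X).hom v) := fun _ => rfl
  have hee : ∀ {X : A} (v : (T.limRep J).obj X), (e.app X).hom ((e.app X).hom v) = (e.app X).hom v := by
    intro X v
    rw [he ((e.app X).hom v), he v, map_sub, hsπ', sub_self, map_zero, sub_zero]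
  have hlow : ∀ j : J, (j : T.Thread α) ≤ j₀ → (e.app _).hom (T.limOf j _ (𝟙 _)) = 0 := by
    intro j hj
    obtain ⟨i, f, hf⟩ := T.exists_limOf ((s.app _).hom (ℓ j))
    have hf' : (P.map f).hom (ℓ i) = ℓ j := by rw [← hπ, hf, hsπ']
    obtain ⟨g, hg⟩ := T.hom_pt f
    -- Since `ℓ j` is not in `N`, the morphism `f` must contain the transition morphism, with
    -- coefficient exactly `1`. This part cancels the class of the identity, and only the part
    -- through the target and the source remains.
    have hk : (e.app _).hom (T.limOf j _ (𝟙 _)) = - T.limOf i _ (T.ηt i.1 ≫ g ≫ T.ηs j.1) := by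
      rcases hg with rfl | ⟨h, c, rfl⟩
      · refine absurd ?_ (hj₀ j hj)
        rw [← hf']
        exact T.map_through_mem g (ℓ i)
      · have hc : c = 1 := by
          by_contra hc
          refine hj₀ j hj ?_
          have h1 : (1 - c) • ℓ j = (P.map (T.ηt i.1 ≫ g ≫ T.ηs j.1)).hom (ℓ i) := by
            rw [map_add_hom hP, map_smul_hom hP, hℓ] at hf'
            rw [sub_smul, one_smul, sub_eq_iff_eq_add', hf']
          have h2 : (1 - c) • ℓ j ∈ N _ := h1 ▸ T.map_through_mem g (ℓ i)
          exact (Submodule.smul_mem_iff _ (sub_ne_zero.2 (Ne.symm hc))).1 h2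
        have h3 : T.limOf i _ (T.η h) = T.limOf j _ (𝟙 _) := by
          rw [← T.limOf_η h, Category.comp_id]
        rw [he, hπ1, ← hf, map_add, map_smul, hc, one_smul, h3, sub_add_cancel_left]
    -- `κ` is the value of `e` at the class of the morphism to the target. It determines `e` at the
    -- identity of `j` and is determined by it; combining both relations gives `(1 + g ≫ ηs ≫ ηt) κ
    -- = 0`. The endomorphism `g ≫ ηs ≫ ηt` of the target is not invertible, so `1` plus it is, by
    -- locality, and `κ = 0`.
    let κ := (e.app _).hom (T.limOf i _ (T.ηt i.1))
    have hτ : T.limOf i _ (T.ηt i.1) = T.limOf j _ (T.ηt j.1) := by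
      simpa using T.limOf_ηt i j (𝟙 _)
    have hk' : (e.app _).hom (T.limOf j _ (𝟙 _)) = - ((T.limRep J).map (g ≫ T.ηs j.1)).hom κ := by
      rw [← app_map_hom, limRep_map_limOf, ← map_neg, ← hk, hee]
    have hκ : κ = ((T.limRep J).map (T.ηt j.1)).hom ((e.app _).hom (T.limOf j _ (𝟙 _))) := by
      rw [← app_map_hom, limRep_map_limOf, Category.id_comp, ← hτ]
    have hκ' : ((T.limRep J).map (𝟙 _ - -(g ≫ T.ηs j.1 ≫ T.ηt j.1))).hom κ = 0 := by
      rw [sub_neg_eq_add, map_add_hom (T.isPwf_limRep hfin), map_id_hom, ← Category.assoc,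
        map_comp_hom, ← neg_neg (((T.limRep J).map (g ≫ T.ηs j.1)).hom κ), ← hk', map_neg, ← hκ,
        add_neg_cancel]
    have hiso : IsIso (𝟙 _ - -(g ≫ T.ηs j.1 ≫ T.ηt j.1)) := by
      rw [← Preadditive.neg_comp]
      exact (isIso_or_isIso_one_sub hloc _).resolve_left (T.not_isIso_tgt j.1 (-g))
    rw [eq_zero_of_map_eq_zero _ hκ', map_zero, neg_zero] at hk'
    exact hk'
  have hsg : ∀ j : J, (e.app _).hom (T.limOf j _ (𝟙 _)) = 0 := by
    intro j
    rcases le_total (j : T.Thread α) j₀ with h | h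
    · exact hlow j h
    · rw [← T.limOf_η h, Category.comp_id, limOf_eq, app_map_hom, hlow j₀ le_rfl, map_zero]
  have hπs : ∀ {X : A} (v : (T.limRep J).obj X), (π.app X).hom v = 0 → v = 0 := by
    intro X v hv
    have he0 : (e.app X).hom v = 0 := by
      obtain ⟨j, f, rfl⟩ := T.exists_limOf v
      rw [limOf_eq, app_map_hom, hsg, map_zero]
    rw [he, hv, map_zero, sub_zero] at he0
    exact he0
  refine ⟨ℓ, hℓ, fun X v => ?_, fun j X f hf => ?_⟩
  · obtain ⟨j, f, hf⟩ := T.exists_limOf ((s.app _).hom v)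
    exact ⟨j, f, by rw [← hπ, hf, hsπ']⟩
  · exact T.limOf_eq_zero (hπs _ ((hπ j f).trans hf))

/-- A hollow functor generated by compatible families on `J`, but not by its value at the end of
the thread, is generated by one compatible family. -/
lemma exists_family (hP : isPwf k A P) (hh : Hollow P) (h0 : ¬ Generates P ∅)
    (ht : ¬ Generates P (elementsAt P {T.tgt α}))
    (L : Submodule k (∀ j : J, P.obj (T.pt α j)))
    (hL : ∀ ℓ ∈ L, ∀ (i j : J) (h : (i : T.Thread α) ≤ j), (P.map (T.η h)).hom (ℓ i) = ℓ j)
    (hJ : Generates P (elementsAt P (T.pt α '' J)))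
    (hgen : Generates P (⋃ ℓ ∈ L, T.familySet ℓ)) : ∃ ℓ ∈ L, Generates P (T.familySet ℓ) := by
  -- A family that vanishes at `j` reaches the object at `j` only through the target: the transition
  -- part of any morphism sends it to a multiple of `ℓ j = 0`. If such families generated for every
  -- `j`, so would the value at the target.
  obtain ⟨j, hj⟩ : ∃ j : J, ¬ Generates P (⋃ ℓ ∈ {ℓ | ℓ ∈ L ∧ ℓ j = 0}, T.familySet ℓ) := by
    by_contra! hcon
    refine ht (hJ.of_forall_mem ?_)
    rintro ⟨_, v⟩ ⟨j, hj, rfl⟩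
    have hle : genSub P (⋃ ℓ ∈ {ℓ | ℓ ∈ L ∧ ℓ ⟨j, hj⟩ = 0}, T.familySet ℓ) (T.pt α j) ≤
        genSub P (elementsAt P {T.tgt α}) (T.pt α j) := by
      refine Submodule.span_le.2 ?_
      rintro _ ⟨g, hg, f, rfl⟩
      obtain ⟨ℓ, ⟨hℓ, hℓ0⟩, i, rfl⟩ := Set.mem_iUnion₂.1 hg
      obtain ⟨g, rfl | ⟨h, c, rfl⟩⟩ := T.hom_pt f
      · exact T.map_through_mem g (ℓ i)
      · rw [map_add_hom hP, map_smul_hom hP, hL ℓ hℓ i ⟨j, hj⟩ h, hℓ0, smul_zero, zero_add]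
        exact T.map_through_mem g (ℓ i)
    exact hle ((hcon ⟨j, hj⟩).mem v)
  have := hP.2 (T.pt α j)
  let p : (∀ j : J, P.obj (T.pt α j)) →ₗ[k] P.obj (T.pt α j) := LinearMap.proj j
  obtain ⟨s, hs⟩ : (L.map p).FG := IsNoetherian.noetherian _
  have hlift : ∀ w : s, ∃ ℓ ∈ L, p ℓ = w := fun w =>
    Submodule.mem_map.1 (hs ▸ Submodule.subset_span w.2)
  choose F hFL hF using hlift
  have hsF : L.map p ≤ (Submodule.span k (Set.range F)).map p := by
    rw [← hs, Submodule.map_span]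
    exact Submodule.span_mono fun w hw => ⟨_, ⟨⟨w, hw⟩, rfl⟩, hF _⟩
  have hFL' : Submodule.span k (Set.range F) ≤ L := by
    rw [Submodule.span_le]
    rintro _ ⟨w, rfl⟩
    exact hFL w
  -- The values at `j` of the families in `L` form a finite-dimensional space, so each family is a
  -- combination of the finitely many in `F` plus one that vanishes at `j`. Hollowness then leaves a
  -- single member of `F`.
  have h1 : Generates P ((⋃ ℓ ∈ Set.range F, T.familySet ℓ) ∪
      ⋃ ℓ ∈ {ℓ | ℓ ∈ L ∧ ℓ j = 0}, T.familySet ℓ) := by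
    refine hgen.of_forall_mem fun g hg => ?_
    obtain ⟨ℓ, hℓ, i, rfl⟩ := Set.mem_iUnion₂.1 hg
    obtain ⟨ℓ', hℓ', hj'⟩ := hsF (Submodule.mem_map_of_mem hℓ)
    have h2 : ℓ i = ℓ' i + (ℓ - ℓ') i := by simp
    rw [genSub_union]
    change ℓ i ∈ _
    rw [h2]
    refine Submodule.add_mem_sup ?_ (mem_genSub_of_mem (Set.mem_biUnion ⟨sub_mem hℓ (hFL' hℓ'), ?_⟩
      ⟨i, rfl⟩))
    · have hle : Submodule.span k (Set.range F) ≤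
          (genSub P (⋃ ℓ ∈ Set.range F, T.familySet ℓ) (T.pt α i)).comap (LinearMap.proj i) :=
        Submodule.span_le.2 fun ℓ hℓ => mem_genSub_of_mem (Set.mem_biUnion hℓ ⟨i, rfl⟩)
      exact hle hℓ'
    · exact sub_eq_zero.2 hj'.symm
  rcases hh _ _ h1 with h | h
  · obtain ⟨_, ⟨w, rfl⟩, h⟩ := hh.exists_of_finite h0 (Set.finite_range F) _ h
    exact ⟨_, hFL w, h⟩
  · exact absurd h hj

/-- The interval is the set of points above which, inclusively, the values fail to generate `P`. Far
down in it the generators recur without end, which is what produces compatible families. -/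
lemma exists_isIntervalRep (hfin : ∀ X Y : A, FiniteDimensional k (X ⟶ Y))
    (hloc : ∀ X : A, IsLocalRing (End X)) (hP : isPwf k A P) (hs : SplitsEpis P) (hh : Hollow P)
    (h0 : ¬ Generates P ∅) (hX : ∀ X, ¬ Generates P (elementsAt P {X}))
    (hα : Generates P (elementsAt P (Set.range (T.pt α)))) :
    ∃ J : Set (T.Thread α), J.Nonempty ∧ J.OrdConnected ∧ T.IsIntervalRep J P := by
  let E : Set (T.Thread α) → Set (Σ X, P.obj X) := fun S => elementsAt P (T.pt α '' S)
  have hEmono : ∀ {S S'}, S ⊆ S' → E S ⊆ E S' := fun h => elementsAt_mono P (Set.image_mono h)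
  have hEunion : ∀ {S S'}, Generates P (E (S ∪ S')) → Generates P (E S) ∨ Generates P (E S') := by
    intro S S' h
    refine hh _ _ ?_
    rwa [← elementsAt_union, ← Set.image_union]
  have huniv : Generates P (E Set.univ) := by rwa [← Set.image_univ] at hα
  let N := genSub P (elementsAt P {T.tgt α})
  let U : Set (T.Thread α) := {x | Generates P (E (Set.Ici x))}
  -- The value at `y` alone does not generate, so the values strictly above `y` do; from there `y`
  -- is reached only through the target.
  have hU : ∀ y ∈ U, ∀ v : P.obj (T.pt α y), v ∈ N _ := by
    intro y hy v
    have h1 : Generates P (E (Set.Ioi y)) := by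
      refine (hEunion (S := {y}) (hy.mono (hEmono fun x hx => ?_))).resolve_left fun h => ?_
      · rcases eq_or_lt_of_le (Set.mem_Ici.1 hx) with h | h
        exacts [Or.inl h.symm, Or.inr h]
      · simp only [E, Set.image_singleton] at h
        exact hX _ h
    refine Submodule.span_le.2 ?_ (h1.mem v)
    rintro _ ⟨⟨_, w⟩, ⟨z, hz, rfl⟩, f, rfl⟩
    obtain ⟨g, rfl | ⟨h, c, rfl⟩⟩ := T.hom_pt f
    · exact T.map_through_mem g w
    · exact absurd h (not_le_of_gt hz)
  have hEU : ∀ {S}, Generates P (E S) → Generates P (E (Uᶜ ∩ S)) := by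
    intro S h
    refine (hEunion (S := U) (h.mono (hEmono fun x hx => ?_))).resolve_left fun h => ?_
    · by_cases hxU : x ∈ U
      exacts [Or.inl hxU, Or.inr ⟨hxU, hx⟩]
    · refine hX (T.tgt α) (h.of_forall_mem ?_)
      rintro ⟨_, v⟩ ⟨y, hy, rfl⟩
      exact hU y hy v
  -- For `x` outside `U` the points `≥ x` do not generate, so those `< x` do, and those in `U` can
  -- be discarded. In particular `Uᶜ` has no least element.
  have hJlt : ∀ x ∈ Uᶜ, Generates P (E (Uᶜ ∩ Set.Iio x)) := fun x hx =>
    hEU ((hEunion (S := Set.Iio x) (by rwa [Set.Iio_union_Ici])).resolve_right hx)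
  have hJ : Generates P (E Uᶜ) := by simpa using hEU huniv
  have hne : (Uᶜ).Nonempty := by
    rw [Set.nonempty_iff_ne_empty]
    intro hemp
    rw [hemp] at hJ
    refine h0 (hJ.mono ?_)
    rintro g ⟨x, hx, -⟩
    exact absurd hx (Set.notMem_empty x)
  have hord : (Uᶜ).OrdConnected := ⟨fun x hx y _ z hz hzU =>
    hx (Generates.mono hzU (hEmono (Set.Ici_subset_Ici.2 hz.1)))⟩
  have := hne.to_subtype
  let L : Submodule k (∀ j : (Uᶜ : Set _), P.obj (T.pt α j)) :=
    { carrier := {ℓ | ∀ (i j : (Uᶜ : Set _)) (h : (i : T.Thread α) ≤ j),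
        (P.map (T.η h)).hom (ℓ i) = ℓ j}
      add_mem' := fun {ℓ ℓ'} h h' i j hij => by
        rw [Pi.add_apply, Pi.add_apply, map_add, h i j hij, h' i j hij]
      zero_mem' := fun i j hij => map_zero _
      smul_mem' := fun c ℓ h i j hij => by
        rw [Pi.smul_apply, Pi.smul_apply, map_smul, h i j hij] }
  -- Choose `i ≤ j` whose image in the value at `j` is the stable one. The values on `Uᶜ` below `i`
  -- generate, and their contributions at `j` either pass through `i`, hence lift to compatible
  -- families, or pass through the target, hence lie in `N`.
  have hdec : ∀ (j : (Uᶜ : Set _)) (v : P.obj (T.pt α j)), ∃ ℓ ∈ L, v - ℓ j ∈ N _ := by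
    intro j v
    have := fun j : (Uᶜ : Set _) => hP.2 (T.pt α j)
    obtain ⟨i, hij, hi⟩ := exists_le_forall_mem_range_lift
      (fun j : (Uᶜ : Set _) => P.obj (T.pt α j)) (fun i j h => (P.map (T.η h)).hom)
      (fun i v => by rw [T.η_refl, map_id_hom])
      (fun i j l hij hjl v => by rw [← map_comp_hom, T.η_comp]) j
    have hle : genSub P (E (Uᶜ ∩ Set.Iio i.1)) (T.pt α j) ≤
        LinearMap.range (P.map (T.η (show (i : T.Thread α) ≤ j from hij))).hom ⊔ N _ := by
      refine Submodule.span_le.2 ?_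
      rintro _ ⟨⟨_, w⟩, ⟨z, hz, rfl⟩, f, rfl⟩
      obtain ⟨g, rfl | ⟨h, c, rfl⟩⟩ := T.hom_pt f
      · exact Submodule.mem_sup_right (T.map_through_mem g w)
      · rw [map_add_hom hP, map_smul_hom hP]
        refine add_mem (Submodule.mem_sup_left (Submodule.smul_mem _ _
          ⟨(P.map (T.η hz.2.le)).hom w, ?_⟩)) (Submodule.mem_sup_right (T.map_through_mem g w))
        rw [← map_comp_hom, T.η_comp]
    obtain ⟨s, hs, n, hn, rfl⟩ := Submodule.mem_sup.1 (hle ((hJlt i i.2).mem v))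
    obtain ⟨ℓ, hℓ, rfl⟩ := hi s hs
    exact ⟨ℓ, hℓ, by rwa [add_sub_cancel_left]⟩
  have hLgen : Generates P (⋃ ℓ ∈ L, T.familySet ℓ) := by
    refine (hh _ (elementsAt P {T.tgt α}) (hJ.of_forall_mem ?_)).resolve_right (hX _)
    rintro ⟨_, v⟩ ⟨j, hj, rfl⟩
    obtain ⟨ℓ, hℓ, hv⟩ := hdec ⟨j, hj⟩ v
    rw [genSub_union]
    change v ∈ _
    rw [← add_sub_cancel (ℓ ⟨j, hj⟩) v]
    exact Submodule.add_mem_sup (mem_genSub_of_mem (Set.mem_biUnion hℓ ⟨⟨j, hj⟩, rfl⟩)) hv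
  obtain ⟨ℓ, hℓ, hgen⟩ := T.exists_family hP hh h0 (hX _) L (fun ℓ hℓ => hℓ) hJ hLgen
  exact ⟨Uᶜ, hne, hord, T.isIntervalRep_of_generates hfin (hloc _) hP hs (hX _) ℓ hℓ hgen⟩

/-- For each vertex there are only finitely many vertices with a nonzero morphism to it. -/
def LeftBounded : Prop :=
  ∀ X ∈ T.vertices, {Y | Y ∈ T.vertices ∧ ∃ f : Y ⟶ X, f ≠ 0}.Finite

/-- A pointwise finite-dimensional representation with local endomorphism ring, onto which all
pointwise surjections split, is representable or the direct limit of the functors represented by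
an interval of a thread. -/
theorem isRepresentedBy_or_isIntervalRep (hfin : ∀ X Y : A, FiniteDimensional k (X ⟶ Y))
    (hloc : ∀ X : A, IsLocalRing (End X)) (hb : T.LeftBounded) (hP : isPwf k A P)
    (hs : SplitsEpis P) (hl : HasLocalEnd P) (hne : ∃ X, ∃ v : P.obj X, v ≠ 0) :
    (∃ X, IsRepresentedBy P X) ∨ ∃ (α : T.Arrow) (J : Set (T.Thread α)),
      J.Nonempty ∧ J.OrdConnected ∧ T.IsIntervalRep J P := by
  have hh := hollow_of_splitsEpis hP hs hl
  have h0 : ¬ Generates P ∅ := fun h => by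
    obtain ⟨X, v, hv⟩ := hne
    exact hv (eq_zero_of_generates_zero h (fun g hg => absurd hg (Set.notMem_empty g)) v)
  by_cases hX : ∃ X, Generates P (elementsAt P {X})
  · obtain ⟨X, hX⟩ := hX
    have := hP.2 X
    obtain ⟨v, hv⟩ := hh.exists_element h0 hX
    exact Or.inl ⟨X, isRepresentedBy_of_generates hfin (hloc X) hP hs h0 hv⟩
  push Not at hX
  have huniv : ∀ S : Set A, Generates P (elementsAt P S) ∨ Generates P (elementsAt P Sᶜ) := by
    intro S
    refine hh _ _ fun X => top_le_iff.1 fun v _ => mem_genSub_of_mem ?_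
    exact em (X ∈ S)
  by_cases hα : ∃ α, Generates P (elementsAt P (Set.range (T.pt α)))
  · obtain ⟨α, hα⟩ := hα
    obtain ⟨J, hJ⟩ := T.exists_isIntervalRep hfin hloc hP hs hh h0 hX hα
    exact Or.inr ⟨α, J, hJ⟩
  push Not at hα
  exfalso
  -- No thread generates, so by hollowness its complement does; morphisms from the complement into
  -- the thread factor through its source, which is a vertex.
  have hv : Generates P (elementsAt P T.vertices) := by
    refine (huniv Set.univ).elim (fun h => h.of_forall_mem ?_) fun h => absurd (h.mono ?_) h0
    · rintro ⟨X, v⟩ -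
      rcases T.cover X with hX | ⟨α, y, rfl⟩
      · exact mem_genSub_of_mem hX
      · refine Submodule.span_le.2 ?_ (((huniv _).resolve_left (hα α)).mem v)
        rintro _ ⟨⟨Z, w⟩, hZ, f, rfl⟩
        obtain ⟨g, rfl⟩ := T.factor_src α Z hZ y f
        rw [SetLike.mem_coe, map_comp_hom]
        exact map_mem_genSub_of_mem _ (T.src_mem α)
    · rintro g hg
      exact hg trivial
  obtain ⟨X, hXv, v, hXne⟩ : ∃ X ∈ T.vertices, ∃ v : P.obj X, v ≠ 0 := by
    by_contra! hcon
    obtain ⟨X, v, hv'⟩ := hne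
    refine hv' (eq_zero_of_generates_zero hv (fun g hg f => ?_) v)
    rw [hcon g.1 hg g.2, map_zero]
  let S := {Y | Y ∈ T.vertices ∧ ∃ f : Y ⟶ X, f ≠ 0}
  have h1 : Generates P (elementsAt P S ∪ elementsAt P (T.vertices \ S)) := hv.mono fun g hg => by
    by_cases hgS : g.1 ∈ S
    exacts [Or.inl hgS, Or.inr ⟨hg, hgS⟩]
  -- The vertices outside `S` have no nonzero morphism to `X`, so they cannot generate the nonzero
  -- value there. The finite set `S` would leave a single generating vertex, which is excluded.
  rcases hh _ _ h1 with h | h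
  · have h2 : Generates P (⋃ Y ∈ S, elementsAt P {Y}) :=
      h.mono fun g hg => Set.mem_biUnion hg (show g.1 ∈ ({g.1} : Set A) from rfl)
    obtain ⟨Y, -, hY⟩ := hh.exists_of_finite h0 (hb X hXv) _ h2
    exact hX Y hY
  · refine hXne (eq_zero_of_generates_zero h (fun g hg f => ?_) v)
    have hf : f = 0 := by
      by_contra hf
      exact hg.2 ⟨hg.1, f, hf⟩
    rw [hf, map_zero_hom hP]

end ThreadStructure

/-! ### The opposite category -/

section Opposite

variable {k : Type u} [Field k] {A : Type u} [Category.{u} A] [Preadditive A] [Linear k A]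

/-- The opposite of a linear category is linear. -/
instance linearOpposite : Linear k Aᵒᵖ where
  homModule X Y :=
    { smul := fun c f => (c • f.unop).op
      one_smul := fun f => Quiver.Hom.unop_inj (one_smul k f.unop)
      mul_smul := fun c d f => Quiver.Hom.unop_inj (mul_smul c d f.unop)
      smul_zero := fun c => Quiver.Hom.unop_inj (smul_zero (A := (Y.unop ⟶ X.unop)) c)
      smul_add := fun c f g => Quiver.Hom.unop_inj (smul_add c f.unop g.unop)
      add_smul := fun c d f => Quiver.Hom.unop_inj (add_smul c d f.unop)
      zero_smul := fun f => Quiver.Hom.unop_inj (zero_smul k f.unop) }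
  smul_comp _ _ _ c f g := Quiver.Hom.unop_inj (Linear.comp_smul _ _ _ g.unop c f.unop)
  comp_smul _ _ _ f c g := Quiver.Hom.unop_inj (Linear.smul_comp _ _ _ c g.unop f.unop)

lemma finiteDimensional_hom_op (hfin : ∀ X Y : A, FiniteDimensional k (X ⟶ Y)) (X Y : Aᵒᵖ) :
    FiniteDimensional k (X ⟶ Y) := by
  have := hfin Y.unop X.unop
  let e : (Y.unop ⟶ X.unop) →ₗ[k] (X ⟶ Y) :=
    { toFun := fun f => f.op
      map_add' := fun _ _ => rfl
      map_smul' := fun _ _ => rfl }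
  exact Module.Finite.of_surjective e fun f => ⟨f.unop, rfl⟩

lemma isLocalRing_end_op (hloc : ∀ X : A, IsLocalRing (End X)) (X : Aᵒᵖ) : IsLocalRing (End X) := by
  have h := hloc X.unop
  have : Nontrivial (End X) :=
    ⟨𝟙 X, 0, fun h0 => one_ne_zero (α := End X.unop) (congrArg Quiver.Hom.unop h0)⟩
  refine ⟨fun {a b} hab => ?_⟩
  rw [isUnit_iff_isIso, isUnit_iff_isIso]
  have h1 := PwfRep.isIso_or_isIso_one_sub h (Quiver.Hom.unop a)
  have h2 : 𝟙 X.unop - Quiver.Hom.unop a = Quiver.Hom.unop b :=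
    sub_eq_of_eq_add' (congrArg Quiver.Hom.unop hab).symm
  rwa [h2, isIso_unop_iff, isIso_unop_iff] at h1

/-- The thread structure of the opposite category. -/
def ThreadStructure.op (T : ThreadStructure k A) : ThreadStructure k Aᵒᵖ where
  vertices := {X | X.unop ∈ T.vertices}
  Arrow := T.Arrow
  Thread α := (T.Thread α)ᵒᵈ
  src α := .op (T.tgt α)
  tgt α := .op (T.src α)
  pt α x := .op (T.pt α (OrderDual.ofDual x))
  η h := (T.η (OrderDual.ofDual_le_ofDual.2 h)).op
  ηs x := (T.ηt (OrderDual.ofDual x)).op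
  ηt x := (T.ηs (OrderDual.ofDual x)).op
  η_refl x := congrArg Quiver.Hom.op (T.η_refl _)
  η_comp h h' := congrArg Quiver.Hom.op (T.η_comp _ _)
  ηs_comp h := congrArg Quiver.Hom.op (T.comp_ηt _)
  comp_ηt h := congrArg Quiver.Hom.op (T.ηs_comp _)
  src_mem := T.tgt_mem
  tgt_mem := T.src_mem
  cover X := (T.cover X.unop).imp id fun ⟨α, x, hx⟩ =>
    ⟨α, OrderDual.toDual x, congrArg Opposite.op hx⟩
  notMem_range α X hX := fun ⟨x, hx⟩ => T.notMem_range α X.unop hX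
    ⟨OrderDual.ofDual x, congrArg Opposite.unop hx⟩
  factor_src α X hX y f := by
    obtain ⟨g, hg⟩ := T.factor_tgt α X.unop
      (fun ⟨x, hx⟩ => hX ⟨OrderDual.toDual x, congrArg Opposite.op hx⟩) _ f.unop
    exact ⟨g.op, Quiver.Hom.unop_inj hg⟩
  factor_tgt α X hX y f := by
    obtain ⟨g, hg⟩ := T.factor_src α X.unop
      (fun ⟨x, hx⟩ => hX ⟨OrderDual.toDual x, congrArg Opposite.op hx⟩) _ f.unop
    exact ⟨g.op, Quiver.Hom.unop_inj hg⟩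
  hom_pt {α x y} f := by
    obtain ⟨g, hg⟩ := T.hom_pt f.unop
    refine ⟨g.op, hg.imp (fun h => Quiver.Hom.unop_inj ?_)
      fun ⟨h, c, h'⟩ => ⟨h, c, Quiver.Hom.unop_inj ?_⟩⟩
    · exact h.trans (Category.assoc _ _ _).symm
    · exact h'.trans (congrArg (c • T.η h + ·) (Category.assoc _ _ _).symm)
  not_isIso_tgt x g h := by
    have h' := (isIso_unop_iff _).2 h
    exact T.not_isIso_src (OrderDual.ofDual x) g.unop (by simpa using h')
  not_isIso_src x g h := by
    have h' := (isIso_unop_iff _).2 h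
    exact T.not_isIso_tgt (OrderDual.ofDual x) g.unop (by simpa using h')

end Opposite

namespace PwfRep

/-! ### Duality between representations of a category and of its opposite -/

section Duality

variable {k : Type u} [Field k] {A : Type u} [Category.{u} A]

/-- The dual of a representation. -/
def dual (M : A ⥤ ModuleCat.{u} k) : Aᵒᵖ ⥤ ModuleCat.{u} k := M.op ⋙ dualFunctor k

/-- The dual of a representation of the opposite category. -/
def codual (N : Aᵒᵖ ⥤ ModuleCat.{u} k) : A ⥤ ModuleCat.{u} k := N.rightOp ⋙ dualFunctor k

lemma exists_ne_zero_dual {E : A ⥤ ModuleCat.{u} k} (h : ∃ X, ∃ v : E.obj X, v ≠ 0) : ∃ X, ∃ v : (dual E).obj X, v ≠ 0 := by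
  obtain ⟨X, v, hv⟩ := h
  by_contra! hcon
  exact hv ((Module.forall_dual_apply_eq_zero_iff k v).1 fun φ =>
    LinearMap.congr_fun (hcon (.op X) φ) v)

variable [Preadditive A] [Linear k A] {M E : A ⥤ ModuleCat.{u} k} {N : Aᵒᵖ ⥤ ModuleCat.{u} k}

lemma isPwf_dual (hM : isPwf k A M) : isPwf k Aᵒᵖ (dual M) := by
  refine isPwf_mk _ (fun {X Y} f g (φ : Module.Dual k (M.obj X.unop)) =>
      LinearMap.ext fun v : M.obj Y.unop => ?_)
    (fun {X Y} c f (φ : Module.Dual k (M.obj X.unop)) =>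
      LinearMap.ext fun v : M.obj Y.unop => ?_) fun X => ?_
  · change φ ((M.map (f.unop + g.unop)).hom v) = φ ((M.map f.unop).hom v) + φ ((M.map g.unop).hom v)
    rw [map_add_hom hM, map_add]
  · change φ ((M.map (c • f.unop)).hom v) = c • φ ((M.map f.unop).hom v)
    rw [map_smul_hom hM, map_smul]
  · have := hM.2 X.unop
    exact inferInstanceAs (FiniteDimensional k (Module.Dual k (M.obj X.unop)))

lemma isPwf_codual (hN : isPwf k Aᵒᵖ N) : isPwf k A (codual N) := by
  refine isPwf_mk _ (fun {X Y} f g (φ : Module.Dual k (N.obj (.op X))) =>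
      LinearMap.ext fun v : N.obj (.op Y) => ?_)
    (fun {X Y} c f (φ : Module.Dual k (N.obj (.op X))) =>
      LinearMap.ext fun v : N.obj (.op Y) => ?_) fun X => ?_
  · change φ ((N.map (f.op + g.op)).hom v) = φ ((N.map f.op).hom v) + φ ((N.map g.op).hom v)
    rw [map_add_hom hN, map_add]
  · change φ ((N.map (c • f.op)).hom v) = c • φ ((N.map f.op).hom v)
    rw [map_smul_hom hN, map_smul]
  · have := hN.2 (.op X)
    exact inferInstanceAs (FiniteDimensional k (Module.Dual k (N.obj (.op X))))

/-- The morphism to the dual of `N` given by a morphism from `N` to the dual of `E`. -/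
def toCodual (π : N ⟶ dual E) : E ⟶ codual N where
  app X := ModuleCat.ofHom (LinearMap.flip
    (show N.obj (.op X) →ₗ[k] Module.Dual k (E.obj X) from (π.app (.op X)).hom))
  naturality X Y f := by
    refine ModuleCat.hom_ext (LinearMap.ext fun v => LinearMap.ext fun n => ?_)
    exact (LinearMap.congr_fun (app_map_hom π f.op n) v).symm

/-- The morphism from the dual of `E` given by a morphism from the dual of `N` to `E`. -/
noncomputable def fromDual (hN : isPwf k Aᵒᵖ N) (r : codual N ⟶ E) : dual E ⟶ N where
  app X :=
    have := hN.2 X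
    ModuleCat.ofHom ((Module.evalEquiv k (N.obj X)).symm.toLinearMap ∘ₗ
      (show (Module.Dual k (N.obj X) →ₗ[k] E.obj X.unop) from (r.app X.unop).hom).dualMap)
  naturality X Y f := by
    have := hN.2 X
    have := hN.2 Y
    refine ModuleCat.hom_ext (LinearMap.ext fun φ : Module.Dual k (E.obj X.unop) =>
      (Module.evalEquiv k (N.obj Y)).injective (LinearMap.ext fun ψ => ?_))
    have h1 := LinearMap.congr_fun ((Module.evalEquiv k (N.obj Y)).apply_symm_apply
      ((r.app Y.unop).hom.dualMap ((E.map f.unop).hom.dualMap φ))) ψ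
    have h2 := LinearMap.congr_fun ((Module.evalEquiv k (N.obj X)).apply_symm_apply
      ((r.app X.unop).hom.dualMap φ)) ((N.map f).hom.dualMap ψ)
    exact h1.trans ((congrArg φ (app_map_hom r f.unop ψ)).symm.trans h2.symm)

lemma apply_fromDual (hN : isPwf k Aᵒᵖ N) (r : codual N ⟶ E) {X : A}
    (φ : Module.Dual k (E.obj X)) (ψ : Module.Dual k (N.obj (.op X))) :
    ψ (((fromDual hN r).app (.op X)).hom φ) = φ ((r.app X).hom ψ) := by
  have := hN.2 (.op X)
  exact LinearMap.congr_fun ((Module.evalEquiv k (N.obj (.op X))).apply_symm_apply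
    ((r.app X).hom.dualMap φ)) ψ

/-- A surjection onto the dual of `E` transposes to an injection of `E` into the dual of its source.
A retraction of that injection transposes back to a section, by reflexivity of finite-dimensional
spaces. -/
lemma splitsEpis_dual (hE : SplitsMonos E) : SplitsEpis (dual E) := by
  intro M hM π hπ
  obtain ⟨r, hr⟩ := hE _ (isPwf_codual hM) (toCodual π) fun X =>
    (injective_iff_map_eq_zero _).2 fun v hv => by
      refine (Module.forall_dual_apply_eq_zero_iff k v).1 fun φ => ?_
      obtain ⟨m, rfl⟩ := hπ (.op X) φ
      exact LinearMap.congr_fun hv m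
  refine ⟨fromDual hM r, ?_⟩
  refine NatTrans.ext (funext fun X => ModuleCat.hom_ext (LinearMap.ext
    fun φ : Module.Dual k (E.obj X.unop) => ?_))
  refine LinearMap.ext fun v : E.obj X.unop => ?_
  have hv : (r.app X.unop).hom (((toCodual π).app X.unop).hom v) = v :=
    congrArg (fun q => (q.app X.unop).hom v) hr
  exact (apply_fromDual hM r φ (((toCodual π).app X.unop).hom v)).trans (congrArg φ hv)

/-- The double dual of a pointwise finite-dimensional representation. -/
noncomputable def codualDualIso (hM : isPwf k A M) : M ≅ codual (dual M) :=
  have : IsIso (toCodual (𝟙 (dual M))) := isIso_of_bijective _ fun X => by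
    have := hM.2 X
    exact (Module.evalEquiv k (M.obj X)).bijective
  asIso (toCodual (𝟙 (dual M)))

/-- The functoriality of the dual. -/
def codualMap {N N' : Aᵒᵖ ⥤ ModuleCat.{u} k} (φ : N ⟶ N') : codual N' ⟶ codual N where
  app X := ModuleCat.ofHom (φ.app (.op X)).hom.dualMap
  naturality X Y f := by
    refine ModuleCat.hom_ext (LinearMap.ext fun v : Module.Dual k (N'.obj (.op X)) =>
      LinearMap.ext fun n => ?_)
    exact congrArg v (app_map_hom φ f.op n).symm

/-- Isomorphic representations have isomorphic duals. -/
def codualIso {N N' : Aᵒᵖ ⥤ ModuleCat.{u} k} (e : N ≅ N') : codual N ≅ codual N' where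
  hom := codualMap e.inv
  inv := codualMap e.hom
  hom_inv_id := by
    refine NatTrans.ext (funext fun X => ModuleCat.hom_ext (LinearMap.ext
      fun v : Module.Dual k (N.obj (.op X)) => LinearMap.ext fun n => ?_))
    exact congrArg v (congrArg (fun q => (q.app (.op X)).hom n) e.hom_inv_id)
  inv_hom_id := by
    refine NatTrans.ext (funext fun X => ModuleCat.hom_ext (LinearMap.ext
      fun v : Module.Dual k (N'.obj (.op X)) => LinearMap.ext fun n => ?_))
    exact congrArg v (congrArg (fun q => (q.app (.op X)).hom n) e.inv_hom_id)

/-- Each endomorphism of the dual is the transpose of one of `E`, additively. If the latter is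
invertible, its transpose is pointwise injective, and this suffices in finite dimension. -/
lemma hasLocalEnd_dual (hE : isPwf k A E) (hl : HasLocalEnd E) : HasLocalEnd (dual E) := by
  have key : ∀ f : dual E ⟶ dual E, ∀ X (v : E.obj X) (φ : Module.Dual k (E.obj X)),
      φ (((toCodual f ≫ (codualDualIso hE).inv).app X).hom v) =
        (show Module.Dual k (E.obj X) from (f.app (.op X)).hom φ) v := by
    intro f X v φ
    have h : (toCodual f ≫ (codualDualIso hE).inv) ≫ toCodual (𝟙 (dual E)) = toCodual f := by
      rw [Category.assoc]
      exact (congrArg (toCodual f ≫ ·) (codualDualIso hE).inv_hom_id).trans (Category.comp_id _)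
    exact LinearMap.congr_fun (congrArg (fun q => (q.app X).hom v) h) φ
  have hiso : ∀ f : dual E ⟶ dual E, IsIso (toCodual f ≫ (codualDualIso hE).inv) → IsIso f := by
    intro f hf
    refine isIso_of_injective (isPwf_dual hE) f fun X => (injective_iff_map_eq_zero _).2 ?_
    intro φ hφ
    refine LinearMap.ext fun w : E.obj X.unop => ?_
    obtain ⟨v, rfl⟩ := (bijective_of_isIso (toCodual f ≫ (codualDualIso hE).inv) X.unop).2 w
    exact (key f X.unop v φ).trans (LinearMap.congr_fun hφ v)
  intro f g hfg
  refine (hl _ _ ?_).imp (hiso f) (hiso g)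
  ext X v
  refine (Module.eval_apply_injective k).eq_iff.1 (LinearMap.ext fun φ => ?_)
  have h1 := LinearMap.congr_fun (congrArg (fun q => (q.app (.op X)).hom φ) hfg) v
  exact (map_add φ _ _).trans ((congrArg₂ (· + ·) (key f X v φ) (key g X v φ)).trans h1)

end Duality

/-! ### Recognizing filtered colimits of representables -/

section Recognition

variable {k : Type u} [Field k] {B : Type u} [Category.{u} B] {K : Type u} [Category.{u} K]

/-- A filtered colimit of representations is recognized on elements. -/
lemma nonempty_iso_colimit [IsFiltered K] (F : K ⥤ B ⥤ ModuleCat.{u} k) (c : Cocone F)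
    (hsurj : ∀ X (v : c.pt.obj X), ∃ j, ∃ w : (F.obj j).obj X, ((c.ι.app j).app X).hom w = v)
    (hzero : ∀ j X (w : (F.obj j).obj X), ((c.ι.app j).app X).hom w = 0 →
      ∃ j', ∃ f : j ⟶ j', ((F.map f).app X).hom w = 0) : Nonempty (c.pt ≅ colimit F) := by
  have hι : ∀ j X (w : (F.obj j).obj X), ((colimit.desc F c).app X).hom
      (((colimit.ι F j).app X).hom w) = ((c.ι.app j).app X).hom w := fun j X w =>
    congrArg (fun q => (q.app X).hom w) (colimit.ι_desc c j)
  have : IsIso (colimit.desc F c) := isIso_of_bijective _ fun X => by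
    constructor
    · refine (injective_iff_map_eq_zero _).2 fun x hx => ?_
      obtain ⟨j, w, rfl⟩ := Concrete.isColimit_exists_rep _ (isColimitOfPreserves
        ((evaluation B (ModuleCat.{u} k)).obj X) (colimit.isColimit F)) x
      obtain ⟨j', f, hf⟩ := hzero j X w ((hι j X w).symm.trans hx)
      have h1 : ((colimit.ι F j').app X).hom (((F.map f).app X).hom w) =
          ((colimit.ι F j).app X).hom w :=
        congrArg (fun q => (q.app X).hom w) (colimit.w F f)
      exact h1.symm.trans (by rw [hf, map_zero])
    · intro v
      obtain ⟨j, w, rfl⟩ := hsurj X v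
      exact ⟨_, hι j X w⟩
  exact ⟨(asIso (colimit.desc F c)).symm⟩

variable [Preadditive B] [Linear k B]

lemma nonempty_iso_colimit_linearCoyoneda [IsCofiltered K] (F : K ⥤ B) {P : B ⥤ ModuleCat.{u} k}
    (hP : isPwf k B P) (ℓ : ∀ j, P.obj (F.obj j))
    (hℓ : ∀ {i j} (h : i ⟶ j), (P.map (F.map h)).hom (ℓ i) = ℓ j)
    (hgen : ∀ X (v : P.obj X), ∃ j, ∃ f : F.obj j ⟶ X, (P.map f).hom (ℓ j) = v)
    (hrel : ∀ j X (f : F.obj j ⟶ X), (P.map f).hom (ℓ j) = 0 → ∃ i, ∃ h : i ⟶ j, F.map h ≫ f = 0) :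
    Nonempty (P ≅ colimit (F.op ⋙ linearCoyoneda k B)) := by
  refine nonempty_iso_colimit (F.op ⋙ linearCoyoneda k B)
    { pt := P
      ι :=
        { app := fun j => homLift hP (ℓ j.unop)
          naturality := fun i j h => ?_ } } ?_ ?_
  · refine NatTrans.ext (funext fun X => ModuleCat.hom_ext (LinearMap.ext
      fun f : F.obj i.unop ⟶ X => ?_))
    change (P.map (F.map h.unop ≫ f)).hom (ℓ j.unop) = (P.map f).hom (ℓ i.unop)
    rw [map_comp_hom, hℓ]
  · intro X v
    obtain ⟨j, f, hf⟩ := hgen X v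
    exact ⟨.op j, f, hf⟩
  · intro j X f hf
    obtain ⟨i, h, hi⟩ := hrel j.unop X f hf
    exact ⟨.op i, h.op, hi⟩

/-- The morphism from a contravariant representable functor given by an element. -/
def homOpLift {P : Bᵒᵖ ⥤ ModuleCat.{u} k} (hP : isPwf k Bᵒᵖ P) {X : B} (v : P.obj (.op X)) :
    (linearYoneda k B).obj X ⟶ P where
  app Y := ModuleCat.ofHom
    { toFun := fun f : Y.unop ⟶ X => (P.map f.op).hom v
      map_add' := fun f g => map_add_hom hP f.op g.op v
      map_smul' := fun c f => map_smul_hom hP c f.op v }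
  naturality Y Z f := by
    refine ModuleCat.hom_ext (LinearMap.ext fun g : Y.unop ⟶ X => ?_)
    exact map_comp_hom P g.op f v

lemma nonempty_iso_colimit_linearYoneda [IsFiltered K] (F : K ⥤ B) {P : Bᵒᵖ ⥤ ModuleCat.{u} k}
    (hP : isPwf k Bᵒᵖ P) (ℓ : ∀ j, P.obj (.op (F.obj j)))
    (hℓ : ∀ {i j} (h : i ⟶ j), (P.map (F.map h).op).hom (ℓ j) = ℓ i)
    (hgen : ∀ X (v : P.obj X), ∃ j, ∃ f : .op (F.obj j) ⟶ X, (P.map f).hom (ℓ j) = v)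
    (hrel : ∀ j X (f : .op (F.obj j) ⟶ X), (P.map f).hom (ℓ j) = 0 →
      ∃ i, ∃ h : j ⟶ i, (F.map h).op ≫ f = 0) :
    Nonempty (P ≅ colimit (F ⋙ linearYoneda k B)) := by
  refine nonempty_iso_colimit (F ⋙ linearYoneda k B)
    { pt := P
      ι :=
        { app := fun j => homOpLift hP (ℓ j)
          naturality := fun i j h => ?_ } } ?_ ?_
  · refine NatTrans.ext (funext fun X => ModuleCat.hom_ext (LinearMap.ext
      fun f : X.unop ⟶ F.obj i => ?_))
    change (P.map ((F.map h).op ≫ f.op)).hom (ℓ j) = (P.map f.op).hom (ℓ i)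
    rw [map_comp_hom, hℓ]
  · intro X v
    obtain ⟨j, f, hf⟩ := hgen X v
    exact ⟨j, f.unop, hf⟩
  · intro j X f hf
    obtain ⟨i, h, hi⟩ := hrel j X (Quiver.Hom.op f) hf
    exact ⟨i, h, congrArg Quiver.Hom.unop hi⟩

lemma nonempty_iso_colimit_linearCoyoneda_of_isRepresentedBy [IsCofiltered K] [Quiver.IsThin K]
    (F : K ⥤ B) {P : B ⥤ ModuleCat.{u} k} (hP : isPwf k B P) (i : K) (t : ∀ j, i ⟶ j)
    (h : IsRepresentedBy P (F.obj i)) : Nonempty (P ≅ colimit (F.op ⋙ linearCoyoneda k B)) := by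
  obtain ⟨v, hgen, hrel⟩ := h
  refine nonempty_iso_colimit_linearCoyoneda F hP (fun j => (P.map (F.map (t j))).hom v)
    (fun {j j'} h => ?_) (fun X w => ?_) fun j X f hf => ?_
  · rw [← map_comp_hom, ← F.map_comp, Subsingleton.elim (t j ≫ h) (t j')]
  · obtain ⟨f, hf⟩ := hgen X w
    exact ⟨i, f, by rw [Subsingleton.elim (t i) (𝟙 i), F.map_id, map_id_hom, hf]⟩
  · exact ⟨i, t j, hrel _ _ ((map_comp_hom P _ _ _).trans hf)⟩

lemma nonempty_iso_colimit_linearYoneda_of_isRepresentedBy [IsFiltered K] [Quiver.IsThin K]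
    (F : K ⥤ B) {P : Bᵒᵖ ⥤ ModuleCat.{u} k} (hP : isPwf k Bᵒᵖ P) (i : K) (t : ∀ j, j ⟶ i)
    (h : IsRepresentedBy P (.op (F.obj i))) : Nonempty (P ≅ colimit (F ⋙ linearYoneda k B)) := by
  obtain ⟨v, hgen, hrel⟩ := h
  refine nonempty_iso_colimit_linearYoneda F hP (fun j => (P.map (F.map (t j)).op).hom v)
    (fun {j j'} h => ?_) (fun X w => ?_) fun j X f hf => ?_
  · rw [← map_comp_hom, ← op_comp, ← F.map_comp, Subsingleton.elim (h ≫ t j') (t j)]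
  · obtain ⟨f, hf⟩ := hgen X w
    exact ⟨i, f, by rw [Subsingleton.elim (t i) (𝟙 i), F.map_id, op_id, map_id_hom, hf]⟩
  · exact ⟨i, t j, hrel _ _ ((map_comp_hom P _ _ _).trans hf)⟩

end Recognition

end PwfRep

/-! ### Weights of path-like elements and weakly admissible ideals -/

namespace ThreadQuiver

variable {k : Type u} [Field k] {Q : ThreadQuiver.{u}}

open Classical in
/-- The coefficient `1` for the trivial path-like elements, and `0` for all others. -/
noncomputable def PathLike.weight (k : Type u) [Field k] :
    {X Y : Obj Q} → PathLike Q X Y → k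
  | _, _, .path p => if p.length = 0 then 1 else 0
  | _, _, .into _ _ _ => 0
  | _, _, .out _ _ _ => 0
  | _, _, .through _ _ _ _ _ => 0
  | _, _, .seg _ (x := x) (y := y) _ => if x = y then 1 else 0

lemma PathLike.weight_comp {X Y Z : Obj Q} (p : PathLike Q X Y) (q : PathLike Q Y Z) :
    (p.comp q).weight k = p.weight k * q.weight k := by
  classical
  cases p with
  | seg α h =>
    cases q with
    | seg α h' =>
      rename_i x y z
      simp only [PathLike.comp, PathLike.weight]
      by_cases hxy : x = y
      · simp [hxy]
      · have : x ≠ z := fun hxz => hxy (le_antisymm h (hxz ▸ h'))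
        simp [hxy, this]
    | _ => simp [PathLike.comp, PathLike.weight]
  | path p =>
    cases q with
    | path q =>
      simp only [PathLike.comp, PathLike.weight, Quiver.Path.length_comp, Nat.add_eq_zero_iff]
      split_ifs <;> simp_all
    | _ => simp [PathLike.comp, PathLike.weight]
  | _ => cases q <;> simp [PathLike.comp, PathLike.weight, Quiver.Path.length_comp]

/-- The linear category with one object, of which `k` is the endomorphism ring. -/
abbrev LineCategory (k : Type u) [Field k] : Type u :=
  InducedCategory (ModuleCat.{u} k) fun _ : PUnit.{u + 1} => ModuleCat.of k k

/-- The functor that kills the path-like elements that are not trivial. -/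
noncomputable def weightFunctor (k : Type u) [Field k] (Q : ThreadQuiver.{u}) :
    Obj Q ⥤ LineCategory k where
  obj _ := PUnit.unit
  map p := InducedCategory.homMk (PathLike.weight k p • 𝟙 (ModuleCat.of k k))
  map_id X := by
    refine InducedCategory.hom_ext ?_
    change (PathLike.id X).weight k • 𝟙 (ModuleCat.of k k) = 𝟙 (ModuleCat.of k k)
    cases X <;> simp [PathLike.id, PathLike.weight]
  map_comp p q := by
    refine InducedCategory.hom_ext ?_
    change (PathLike.comp p q).weight k • 𝟙 (ModuleCat.of k k) = (PathLike.weight k p •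
      𝟙 (ModuleCat.of k k)) ≫ (PathLike.weight k q • 𝟙 (ModuleCat.of k k))
    rw [PathLike.weight_comp, Linear.smul_comp, Linear.comp_smul, smul_smul, Category.comp_id]

lemma weightFunctor_map_eq_zero {X Y : Obj Q} (p : X ⟶ Y) (hp : PathLike.weight k p = 0) :
    (weightFunctor k Q).map p = 0 := by
  refine InducedCategory.hom_ext ?_
  change PathLike.weight k p • 𝟙 (ModuleCat.of k k) = 0
  rw [hp, zero_smul]

lemma PathLike.weight_eq_zero {X Y : Obj Q} (p : X ⟶ Y) (hp : ∀ h : X = Y, p ≠ eqToHom h) :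
    PathLike.weight k p = 0 := by
  change PathLike Q X Y at p
  cases p with
  | path p =>
    cases p with
    | nil => exact absurd rfl (hp rfl)
    | cons p e => simp [PathLike.weight]
  | seg α h =>
    rename_i x y
    have : x ≠ y := by
      rintro rfl
      exact hp rfl rfl
    simp [PathLike.weight, this]
  | _ => rfl

/-- The kernel of a linear functor. -/
def kernelIdeal {C : Type u} [Category.{u} C] [Preadditive C] [Linear k C] {D : Type*}
    [Category D] [Preadditive D] [Linear k D] (F : C ⥤ D) [F.Additive] [F.Linear k] :
    HomIdeal k C where
  hom X Y := LinearMap.ker (F.mapLinearMap k (X := X) (Y := Y))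
  comp_left f g hg := by
    change F.map (f ≫ g) = 0
    rw [F.map_comp, show F.map g = 0 from hg, comp_zero]
  comp_right g hf := by
    change F.map (_ ≫ g) = 0
    rw [F.map_comp, show F.map _ = 0 from hf, zero_comp]

variable (I : HomIdeal k (PathCategory k Q))

lemma pathRadical_le_ker {X Y : PathCategory k Q} {f : X ⟶ Y} (hf : f ∈ (pathRadical k Q).hom X Y) :
    (Free.lift k (weightFunctor k Q)).map f = 0 := by
  refine (Submodule.mem_iInf _).1 hf ⟨kernelIdeal (Free.lift k (weightFunctor k Q)), ?_⟩
  rintro X Y _ ⟨p, hp, rfl⟩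
  change (Free.lift k (weightFunctor k Q)).map ((Free.embedding k (Obj Q)).map p) = 0
  refine (Free.lift_map_single k (weightFunctor k Q) p (1 : k)).trans ?_
  rw [weightFunctor_map_eq_zero p (PathLike.weight_eq_zero p hp), smul_zero]

variable {I}

/-- The ideal is generated inside the path-like radical, which the weight functor kills. Hence that
functor descends to the quotient category. -/
lemma WeaklyAdmissible.le_ker (hI : WeaklyAdmissible I) {X Y : PathCategory k Q} {f : X ⟶ Y}
    (hf : f ∈ I.hom X Y) : (Free.lift k (weightFunctor k Q)).map f = 0 := by
  obtain ⟨S, hS, rfl⟩ := hI.generated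
  exact pathRadical_le_ker ((Submodule.mem_iInf _).1 hf ⟨pathRadical k Q, hS⟩)

variable (I) in
/-- The functor from path-like elements to the quotient category. -/
noncomputable abbrev toQuot : Obj Q ⥤ I.Quot := Free.embedding k (Obj Q) ⋙ I.proj

/-- The functor on the quotient category that kills the nontrivial path-like elements. -/
noncomputable def WeaklyAdmissible.weight (hI : WeaklyAdmissible I) : I.Quot ⥤ LineCategory k :=
  CategoryTheory.Quotient.lift I.rel (Free.lift k (weightFunctor k Q)) fun X Y f g hfg => by
    have h := hI.le_ker hfg
    rwa [Functor.map_sub, sub_eq_zero] at h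

lemma WeaklyAdmissible.weight_toQuot (hI : WeaklyAdmissible I) {X Y : Obj Q} (p : X ⟶ Y)
    (hp : PathLike.weight k p = 0) : hI.weight.map ((toQuot I).map p) = 0 := by
  refine (Free.lift_map_single k (weightFunctor k Q) p (1 : k)).trans ?_
  rw [weightFunctor_map_eq_zero p hp, smul_zero]

/-- A functor preserves isomorphisms, and the zero endomorphism of `k` is not one. -/
lemma WeaklyAdmissible.not_isIso (hI : WeaklyAdmissible I) {X Y : I.Quot} (f : X ⟶ Y)
    (hf : hI.weight.map f = 0) : ¬ IsIso f := by
  intro h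
  have h1 : 𝟙 (hI.weight.obj X) = 0 := by
    rw [← hI.weight.map_id, ← IsIso.hom_inv_id f, hI.weight.map_comp, hf, zero_comp]
  have h2 : (1 : k) = 0 := congrArg (fun q => q.hom.hom (1 : k)) h1
  exact one_ne_zero h2

lemma hom_mem_of_forall {X Y : Obj Q} (S : Submodule k ((toQuot I).obj X ⟶ (toQuot I).obj Y))
    (hS : ∀ p : X ⟶ Y, (toQuot I).map p ∈ S) (f : (toQuot I).obj X ⟶ (toQuot I).obj Y) : f ∈ S := by
  obtain ⟨f, rfl⟩ := I.proj.map_surjective f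
  let φ : (X ⟶ Y) →₀ k := f
  change I.proj.map (X := Free.of k X) (Y := Free.of k Y) φ ∈ S
  induction φ using Finsupp.induction_linear with
  | zero => exact (I.proj.map_zero _ _).symm ▸ zero_mem S
  | add φ ψ h h' => exact (I.proj.map_add (X := Free.of k X) (Y := Free.of k Y)).symm ▸ add_mem h h'
  | single p c =>
    have h : (Finsupp.single p c : (X ⟶ Y) →₀ k) = c • Finsupp.single p 1 := by simp
    rw [h]
    exact S.smul_mem c (hS p)

end ThreadQuiver

/-! ### The thread structure of the quotient category -/

namespace ThreadQuiver

variable {k : Type u} [Field k] {Q : ThreadQuiver.{u}} {I : HomIdeal k (PathCategory k Q)}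

lemma toQuot_factor_src {a b : Q.Vertex} (α : a ⟶ b) (X : Obj Q) (y : Q.thread α)
    (hX : ∀ x, X ≠ .point α x) (f : (toQuot I).obj X ⟶ (toQuot I).obj (.point α y)) :
    ∃ g : (toQuot I).obj X ⟶ (toQuot I).obj (.vertex a),
      f = g ≫ (toQuot I).map (PathLike.into Quiver.Path.nil α y) := by
  have h := hom_mem_of_forall (I := I) (LinearMap.range (Linear.rightComp k ((toQuot I).obj X)
    ((toQuot I).map (X := .vertex a) (Y := .point α y) (PathLike.into Quiver.Path.nil α y))))
    (fun p => ?_) f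
  · obtain ⟨g, rfl⟩ := h
    exact ⟨g, rfl⟩
  · change PathLike Q X (.point α y) at p
    cases p with
    | into p => exact ⟨(toQuot I).map (PathLike.path p), ((toQuot I).map_comp _ _).symm⟩
    | through β x p => exact ⟨(toQuot I).map (PathLike.out β x p), ((toQuot I).map_comp _ _).symm⟩
    | seg α h => exact absurd rfl (hX _)

lemma toQuot_factor_tgt {a b : Q.Vertex} (α : a ⟶ b) (X : Obj Q) (x : Q.thread α)
    (hX : ∀ x, X ≠ .point α x) (f : (toQuot I).obj (.point α x) ⟶ (toQuot I).obj X) :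
    ∃ g : (toQuot I).obj (.vertex b) ⟶ (toQuot I).obj X,
      f = (toQuot I).map (PathLike.out α x Quiver.Path.nil) ≫ g := by
  have h := hom_mem_of_forall (I := I) (LinearMap.range (Linear.leftComp k ((toQuot I).obj X)
    ((toQuot I).map (X := .point α x) (Y := .vertex b) (PathLike.out α x Quiver.Path.nil))))
    (fun p => ?_) f
  · obtain ⟨g, rfl⟩ := h
    exact ⟨g, rfl⟩
  · change PathLike Q (.point α x) X at p
    cases p with
    | out α x p =>
      refine ⟨(toQuot I).map (PathLike.path p), ((toQuot I).map_comp _ _).symm.trans ?_⟩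
      exact congrArg (toQuot I).map (congrArg (PathLike.out α x) (Quiver.Path.nil_comp p))
    | through α x p β y =>
      refine ⟨(toQuot I).map (PathLike.into p β y), ((toQuot I).map_comp _ _).symm.trans ?_⟩
      exact congrArg (toQuot I).map
        (congrArg (fun q => PathLike.through α x q β y) (Quiver.Path.nil_comp p))
    | seg α h => exact absurd rfl (hX _)

/-- A path-like element between two points of one thread either stays on the thread, and is then the
transition morphism, or leaves it through the target and returns through the source. -/
lemma toQuot_hom_point {a b : Q.Vertex} (α : a ⟶ b) (x y : Q.thread α)
    (f : (toQuot I).obj (.point α x) ⟶ (toQuot I).obj (.point α y)) :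
    ∃ g : (toQuot I).obj (.vertex b) ⟶ (toQuot I).obj (.vertex a),
      f = (toQuot I).map (PathLike.out α x Quiver.Path.nil) ≫ g ≫
        (toQuot I).map (PathLike.into Quiver.Path.nil α y) ∨
      ∃ (h : x ≤ y) (c : k), f = c • (toQuot I).map (PathLike.seg α h) +
        (toQuot I).map (PathLike.out α x Quiver.Path.nil) ≫ g ≫
          (toQuot I).map (PathLike.into Quiver.Path.nil α y) := by
  let τ : ((toQuot I).obj (.vertex b) ⟶ (toQuot I).obj (.vertex a)) →ₗ[k]
      ((toQuot I).obj (.point α x) ⟶ (toQuot I).obj (.point α y)) :=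
    Linear.leftComp k _ ((toQuot I).map (X := .point α x) (Y := .vertex b)
      (PathLike.out α x Quiver.Path.nil)) ∘ₗ Linear.rightComp k _
        ((toQuot I).map (X := .vertex a) (Y := .point α y) (PathLike.into Quiver.Path.nil α y))
  have hτ : ∀ p : Quiver.Path b a,
      (toQuot I).map (X := .point α x) (Y := .point α y) (PathLike.through α x p α y) ∈
        LinearMap.range τ := fun p => by
    refine ⟨(toQuot I).map (PathLike.path p), ?_⟩
    refine (congrArg _ ((toQuot I).map_comp _ _).symm).trans
      (((toQuot I).map_comp _ _).symm.trans (congrArg (toQuot I).map ?_))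
    exact congrArg (fun q => PathLike.through α x q α y) (Quiver.Path.nil_comp p)
  by_cases hxy : x ≤ y
  · have h := hom_mem_of_forall (I := I) (Submodule.span k {(toQuot I).map (X := .point α x)
      (Y := .point α y) (PathLike.seg α hxy)} ⊔ LinearMap.range τ) (fun p => ?_) f
    · obtain ⟨u, hu, v, ⟨g, rfl⟩, rfl⟩ := Submodule.mem_sup.1 h
      obtain ⟨c, rfl⟩ := Submodule.mem_span_singleton.1 hu
      exact ⟨g, Or.inr ⟨hxy, c, rfl⟩⟩
    · change PathLike Q (.point α x) (.point α y) at p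
      cases p with
      | through _ _ p => exact Submodule.mem_sup_right (hτ p)
      | seg _ h => exact Submodule.mem_sup_left (Submodule.mem_span_singleton_self _)
  · have h := hom_mem_of_forall (I := I) (LinearMap.range τ) (fun p => ?_) f
    · obtain ⟨g, rfl⟩ := h
      exact ⟨g, Or.inl rfl⟩
    · change PathLike Q (.point α x) (.point α y) at p
      cases p with
      | through _ _ p => exact hτ p
      | seg _ h => exact absurd h hxy

/-- The thread structure of the quotient of the path category by a weakly admissible ideal. -/
noncomputable def threadStructure (hI : WeaklyAdmissible I) : ThreadStructure k I.Quot where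
  vertices := Set.range (vertexObj I)
  Arrow := Σ a b : Q.Vertex, a ⟶ b
  Thread α := Q.thread α.2.2
  src α := vertexObj I α.1
  tgt α := vertexObj I α.2.1
  pt α x := (toQuot I).obj (.point α.2.2 x)
  η {α _ _} h := (toQuot I).map (PathLike.seg α.2.2 h)
  ηs {α} x := (toQuot I).map (PathLike.into Quiver.Path.nil α.2.2 x)
  ηt {α} x := (toQuot I).map (PathLike.out α.2.2 x Quiver.Path.nil)
  η_refl x := (toQuot I).map_id _
  η_comp h h' := ((toQuot I).map_comp _ _).symm
  ηs_comp h := ((toQuot I).map_comp _ _).symm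
  comp_ηt h := ((toQuot I).map_comp _ _).symm
  src_mem α := ⟨_, rfl⟩
  tgt_mem α := ⟨_, rfl⟩
  cover := by
    rintro ⟨v | ⟨α, x⟩⟩
    · exact Or.inl ⟨v, rfl⟩
    · exact Or.inr ⟨⟨_, _, α⟩, x, rfl⟩
  notMem_range := by
    rintro α _ ⟨v, rfl⟩ ⟨x, hx⟩
    have h : Obj.point α.2.2 x = Obj.vertex v := congrArg (fun X : I.Quot => (X.as : Obj Q)) hx
    cases h
  factor_src := by
    rintro α ⟨X⟩ hX y f
    exact toQuot_factor_src α.2.2 X y (fun x hx => hX ⟨x, hx ▸ rfl⟩) f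
  factor_tgt := by
    rintro α ⟨X⟩ hX y f
    exact toQuot_factor_tgt α.2.2 X y (fun x hx => hX ⟨x, hx ▸ rfl⟩) f
  hom_pt f := toQuot_hom_point _ _ _ f
  -- The composite contains the morphism from the source to a point of the thread, which has weight
  -- zero.
  not_isIso_tgt {α} x g := hI.not_isIso _ (by
    have h := hI.weight_toQuot (X := .vertex α.1) (Y := .point α.2.2 x)
      (PathLike.into Quiver.Path.nil α.2.2 x) rfl
    erw [hI.weight.map_comp, hI.weight.map_comp, h, zero_comp, comp_zero])
  not_isIso_src {α} x g := hI.not_isIso _ (by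
    have h := hI.weight_toQuot (X := .vertex α.1) (Y := .point α.2.2 x)
      (PathLike.into Quiver.Path.nil α.2.2 x) rfl
    erw [hI.weight.map_comp, h, zero_comp])

end ThreadQuiver

/-! ### Intervals of threads with their ends -/

namespace ThreadQuiver

open PwfRep

variable {k : Type u} [Field k] {Q : ThreadQuiver.{u}}

/-- The set of points of a thread, as a subset of the thread with its ends. -/
def barSet {a b : Q.Vertex} (α : a ⟶ b) (J : Set (Q.thread α)) : Set (Q.threadBar α) := fun z =>
  match z with
  | none => False
  | some none => False
  | some (some x) => x ∈ J

/-- A family indexed by points of a thread, as a family indexed by a subset of the thread with its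
ends. -/
def barFamily {a b : Q.Vertex} {α : a ⟶ b} {J : Set (Q.thread α)} {C : Obj Q → Type u}
    (ℓ : ∀ j : J, C (.point α j)) : ∀ z : barSet α J, C (toObj α z)
  | ⟨none, h⟩ => False.elim h
  | ⟨some none, h⟩ => False.elim h
  | ⟨some (some x), h⟩ => ℓ ⟨x, h⟩

lemma barSet_nonempty {a b : Q.Vertex} (α : a ⟶ b) {J : Set (Q.thread α)} (hJ : J.Nonempty) :
    (barSet α J).Nonempty := by
  obtain ⟨x, hx⟩ := hJ
  exact ⟨some (some x), hx⟩

lemma barSet_ordConnected {a b : Q.Vertex} (α : a ⟶ b) {J : Set (Q.thread α)}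
    (hJ : J.OrdConnected) : (barSet α J).OrdConnected := by
  refine ⟨fun x hx y hy z hz => ?_⟩
  rcases x with _ | _ | x
  · exact False.elim hx
  · exact False.elim hx
  rcases y with _ | _ | y
  · exact False.elim hy
  · exact False.elim hy
  rcases z with _ | _ | z
  · exact absurd hz.1 (WithBot.not_coe_le_bot _)
  · exact absurd (WithBot.coe_le_coe.1 hz.2) (WithTop.not_top_le_coe _)
  · exact hJ.out hx hy ⟨WithTop.coe_le_coe.1 (WithBot.coe_le_coe.1 hz.1),
      WithTop.coe_le_coe.1 (WithBot.coe_le_coe.1 hz.2)⟩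

lemma point_le_point {a b : Q.Vertex} {α : a ⟶ b} {x y : Q.thread α} (h : x ≤ y) :
    LE.le (α := Q.threadBar α) (some (some x)) (some (some y)) :=
  WithBot.coe_le_coe.2 (WithTop.coe_le_coe.2 h)

/-- A vertex is an end of some thread because it is incident to an arrow; this places every
representable functor among the `P_J` with `J` a singleton. -/
lemma exists_eq_toObj (hQ : ∀ v : Q.Vertex, ∃ w : Q.Vertex, Nonempty (v ⟶ w) ∨ Nonempty (w ⟶ v))
    (X : Obj Q) : ∃ (a b : Q.Vertex) (α : a ⟶ b) (z : Q.threadBar α), X = toObj α z := by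
  rcases X with v | ⟨α, x⟩
  · obtain ⟨w, h⟩ := hQ v
    rcases h with h | h
    · exact ⟨v, w, h.some, none, rfl⟩
    · exact ⟨w, v, h.some, some none, rfl⟩
  · exact ⟨_, _, α, some (some x), rfl⟩

variable {I : HomIdeal k (PathCategory k Q)}

lemma nonempty_iso_projRep_singleton {P : I.Quot ⥤ ModuleCat.{u} k} (hP : isPwf k I.Quot P)
    {a b : Q.Vertex} (α : a ⟶ b) (z : Q.threadBar α)
    (h : IsRepresentedBy P ((toQuot I).obj (toObj α z))) :
    Nonempty (P ≅ projRep I α {z}) := by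
  have : Nonempty ({z} : Set (Q.threadBar α)) := ⟨⟨z, rfl⟩⟩
  exact nonempty_iso_colimit_linearCoyoneda_of_isRepresentedBy (intervalFunctor I α {z}) hP ⟨z, rfl⟩
    (fun j => homOfLE (le_of_eq (Subtype.ext j.2.symm))) h

lemma nonempty_iso_projRep_barSet (hI : WeaklyAdmissible I) {P : I.Quot ⥤ ModuleCat.{u} k}
    (hP : isPwf k I.Quot P) {α : (threadStructure hI).Arrow}
    {J : Set ((threadStructure hI).Thread α)} (hJ : J.Nonempty)
    (h : (threadStructure hI).IsIntervalRep J P) :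
    Nonempty (P ≅ projRep I α.2.2 (barSet α.2.2 J)) := by
  obtain ⟨ℓ, hℓ, hgen, hrel⟩ := h
  have := (barSet_nonempty α.2.2 hJ).to_subtype
  refine nonempty_iso_colimit_linearCoyoneda (intervalFunctor I α.2.2 (barSet α.2.2 J)) hP
    (barFamily (C := fun X => P.obj ((toQuot I).obj X)) ℓ) ?_ ?_ ?_
  · rintro ⟨_ | _ | x, hx⟩
    · exact False.elim hx
    · exact False.elim hx
    rintro ⟨_ | _ | y, hy⟩ h
    · exact False.elim hy
    · exact False.elim hy
    exact hℓ ⟨x, hx⟩ ⟨y, hy⟩ (WithTop.coe_le_coe.1 (WithBot.coe_le_coe.1 (leOfHom h)))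
  · intro X v
    obtain ⟨⟨x, hx⟩, f, hf⟩ := hgen X v
    exact ⟨⟨some (some x), hx⟩, f, hf⟩
  · rintro ⟨_ | _ | x, hx⟩ X f hf
    · exact False.elim hx
    · exact False.elim hx
    obtain ⟨⟨y, hy⟩, hyx, h0⟩ := hrel ⟨x, hx⟩ X f hf
    exact ⟨⟨some (some y), hy⟩, homOfLE (point_le_point hyx), h0⟩

/-- `I_J` is by construction the dual of a colimit, and `E` is its own double dual. -/
lemma nonempty_iso_injRep {E : I.Quot ⥤ ModuleCat.{u} k} (hE : isPwf k I.Quot E)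
    {a b : Q.Vertex} (α : a ⟶ b) (J : Set (Q.threadBar α))
    (h : Nonempty (dual E ≅ colimit (intervalFunctor I α J ⋙ linearYoneda k I.Quot))) :
    Nonempty (E ≅ injRep I α J) := by
  obtain ⟨e⟩ := h
  exact ⟨codualDualIso hE ≪≫ codualIso e⟩

lemma nonempty_iso_colimit_singleton {P : I.Quotᵒᵖ ⥤ ModuleCat.{u} k} (hP : isPwf k I.Quotᵒᵖ P)
    {a b : Q.Vertex} (α : a ⟶ b) (z : Q.threadBar α)
    (h : IsRepresentedBy P (.op ((toQuot I).obj (toObj α z)))) :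
    Nonempty (P ≅ colimit (intervalFunctor I α {z} ⋙ linearYoneda k I.Quot)) := by
  have : Nonempty ({z} : Set (Q.threadBar α)) := ⟨⟨z, rfl⟩⟩
  exact nonempty_iso_colimit_linearYoneda_of_isRepresentedBy (intervalFunctor I α {z}) hP ⟨z, rfl⟩
    (fun j => homOfLE (le_of_eq (Subtype.ext j.2))) h

lemma nonempty_iso_colimit_barSet (hI : WeaklyAdmissible I) {P : I.Quotᵒᵖ ⥤ ModuleCat.{u} k}
    (hP : isPwf k I.Quotᵒᵖ P) {α : (threadStructure hI).op.Arrow}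
    {J : Set (Q.thread α.2.2)} (hJ : J.Nonempty)
    (h : (threadStructure hI).op.IsIntervalRep (α := α) (OrderDual.ofDual ⁻¹' J) P) :
    Nonempty (P ≅ colimit (intervalFunctor I α.2.2 (barSet α.2.2 J) ⋙
      linearYoneda k I.Quot)) := by
  obtain ⟨ℓ, hℓ, hgen, hrel⟩ := h
  have := (barSet_nonempty α.2.2 hJ).to_subtype
  refine nonempty_iso_colimit_linearYoneda
    (intervalFunctor I α.2.2 (barSet α.2.2 J)) hP
    (barFamily (C := fun X => P.obj (.op ((toQuot I).obj X))) ℓ) ?_ ?_ ?_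
  · rintro ⟨_ | _ | x, hx⟩
    · exact False.elim hx
    · exact False.elim hx
    rintro ⟨_ | _ | y, hy⟩ h
    · exact False.elim hy
    · exact False.elim hy
    have hxy : x ≤ y := WithTop.coe_le_coe.1 (WithBot.coe_le_coe.1 (leOfHom h))
    exact hℓ ⟨y, hy⟩ ⟨x, hx⟩ hxy
  · intro X v
    obtain ⟨⟨x, hx⟩, f, hf⟩ := hgen X v
    exact ⟨⟨some (some x), hx⟩, f, hf⟩
  · rintro ⟨_ | _ | x, hx⟩ X f hf
    · exact False.elim hx
    · exact False.elim hx
    obtain ⟨⟨y, hy⟩, hyx, h0⟩ := hrel ⟨x, hx⟩ X f hf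
    exact ⟨⟨some (some y), hy⟩, homOfLE (point_le_point hyx), h0⟩

lemma leftBounded_threadStructure (hI : WeaklyAdmissible I) (h : LeftBounded I) :
    (threadStructure hI).LeftBounded := by
  rintro _ ⟨x, rfl⟩
  refine ((h x).image (vertexObj I)).subset ?_
  rintro _ ⟨⟨y, rfl⟩, f, hf⟩
  exact ⟨y, ⟨f, hf⟩, rfl⟩

lemma leftBounded_threadStructure_op (hI : WeaklyAdmissible I) (h : RightBounded I) :
    (threadStructure hI).op.LeftBounded := by
  rintro ⟨X⟩ ⟨x, rfl⟩
  refine ((h x).image fun y => Opposite.op (vertexObj I y)).subset ?_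
  rintro ⟨Y⟩ ⟨⟨y, rfl⟩, f, hf⟩
  exact ⟨y, ⟨f.unop, fun h0 => hf (Quiver.Hom.unop_inj h0)⟩, rfl⟩

end ThreadQuiver

/-! ### The classification of indecomposable projectives and injectives -/

open PwfRep in
theorem mainTheorem4 (k : Type u) [Field k] (Q : ThreadQuiver.{u})
    (hQ : ∀ v : Q.Vertex, ∃ w : Q.Vertex, Nonempty (v ⟶ w) ∨ Nonempty (w ⟶ v))
    (I : HomIdeal k (ThreadQuiver.PathCategory k Q)) (hI : ThreadQuiver.WeaklyAdmissible I) :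
    (ThreadQuiver.LeftBounded I →
      ∀ P : RepPwf k I.Quot, Projective P → Indecomposable P →
        ∃ (a b : Q.Vertex) (α : a ⟶ b) (J : Set (Q.threadBar α)),
          J.Nonempty ∧ J.OrdConnected ∧ Nonempty (P.obj ≅ ThreadQuiver.projRep I α J)) ∧
    (ThreadQuiver.RightBounded I →
      ∀ E : RepPwf k I.Quot, Injective E → Indecomposable E →
        ∃ (a b : Q.Vertex) (α : a ⟶ b) (J : Set (Q.threadBar α)),
          J.Nonempty ∧ J.OrdConnected ∧ Nonempty (E.obj ≅ ThreadQuiver.injRep I α J)) := by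
  refine ⟨fun hb P _ hind => ?_, fun hb E _ hind => ?_⟩
  · rcases (ThreadQuiver.threadStructure hI).isRepresentedBy_or_isIntervalRep hI.finite_hom
      hI.isLocalRing_end (ThreadQuiver.leftBounded_threadStructure hI hb) P.property
      (splitsEpis_of_projective P) (hasLocalEnd_of_indecomposable P hind)
      (exists_ne_zero_of_indecomposable P hind) with ⟨⟨X⟩, hX⟩ | ⟨α, J, hJ, hJc, h⟩
    · obtain ⟨a, b, α, z, rfl⟩ := ThreadQuiver.exists_eq_toObj hQ X
      exact ⟨a, b, α, {z}, Set.singleton_nonempty z, Set.ordConnected_singleton,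
        ThreadQuiver.nonempty_iso_projRep_singleton P.property α z hX⟩
    · exact ⟨_, _, α.2.2, ThreadQuiver.barSet α.2.2 J, ThreadQuiver.barSet_nonempty _ hJ,
        ThreadQuiver.barSet_ordConnected _ hJc,
        ThreadQuiver.nonempty_iso_projRep_barSet hI P.property hJ h⟩
  -- The dual of `E` satisfies the hypotheses of the projective case over the opposite category,
  -- where the threads are reversed and right boundedness becomes left boundedness.
  · have hD := isPwf_dual E.property
    rcases (ThreadQuiver.threadStructure hI).op.isRepresentedBy_or_isIntervalRep
      (finiteDimensional_hom_op hI.finite_hom) (isLocalRing_end_op hI.isLocalRing_end)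
      (ThreadQuiver.leftBounded_threadStructure_op hI hb) hD
      (splitsEpis_dual (splitsMonos_of_injective E))
      (hasLocalEnd_dual E.property (hasLocalEnd_of_indecomposable E hind))
      (exists_ne_zero_dual (exists_ne_zero_of_indecomposable E hind))
      with ⟨⟨⟨X⟩⟩, hX⟩ | ⟨α, J, hJ, hJc, h⟩
    · obtain ⟨a, b, α, z, rfl⟩ := ThreadQuiver.exists_eq_toObj hQ X
      exact ⟨a, b, α, {z}, Set.singleton_nonempty z, Set.ordConnected_singleton,
        ThreadQuiver.nonempty_iso_injRep E.property α _
          (ThreadQuiver.nonempty_iso_colimit_singleton hD α z hX)⟩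
    · exact ⟨_, _, α.2.2, ThreadQuiver.barSet α.2.2 (OrderDual.toDual ⁻¹' J),
        ThreadQuiver.barSet_nonempty _ hJ, ThreadQuiver.barSet_ordConnected _ hJc.dual,
        ThreadQuiver.nonempty_iso_injRep E.property _ _
          (ThreadQuiver.nonempty_iso_colimit_barSet hI hD (α := α)
            (J := OrderDual.toDual ⁻¹' J) hJ h)⟩
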